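/- Let $\omega=e^{2\pi i/3}$. Tile the complex plane by regular hexagons (cells) of side length $1$, one of which has vertices $1\pm\omega^j$, $j\in\{0,1,2\}$. For positive integers $a,b$ with $2\le a\le 2b$ and $2\le b\le 2a$, the $(a,b)$-benzel is the union of the cells lying entirely within the hexagon (possibly degenerate) with vertices $\omega^j(a\omega+b)$ and $-\omega^j(a+b\omega)$, $j\in\{0,1,2\}$. A stone consists of three pairwise adjacent cells; the left stone is the one with one cell on the left and two on the right, the right stone the one with one cell on the right and two on the left. A bone consists of three consecutive cells with collinear centres; it is rising, falling or vertical according as the line of centres has direction $e^{i\pi/6}$, $e^{-i\pi/6}$ or $i$. For $n\ge 1$ let $T_n$ (respectively $T'_n$) be the number of tilings of the $(n+2,2n+1)$-benzel (respectively the $(n+2,2n)$-benzel) by left stones, right stones, rising bones and falling bones, and put $T_0=T'_0=1$. Then $$T'_n=T_n-T_{n-1}\qquad(n\ge 1),$$ and, as formal power series, $$\sum_{n=0}^\infty T'_nx^n=(1-x)\,\frac{1-x-\sqrt{1-6x+x^2}}{2x},$$ where $\sqrt{1-6x+x^2}$ is the square root with constant term $1$. In particular $T'_1,T'_2,T'_3,\dots=1,4,16,68,304,\dots$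 is the sequence A006319, the convolution of the large Schröder numbers with themselves: $T'_{n+1}=\sum_{k=0}^n r_kr_{n-k}$ for $n\ge0$, where $r_0=1$ and $r_{m+1}=r_m+\sum_{k=0}^m r_kr_{m-k}$. -/

import Mathlib

namespace HexTiling

noncomputable section

/-- The primitive third root of unity `e ^ (2πi/3)`. -/
def omega : ℂ := Complex.exp (2 * Real.pi * Complex.I / 3)

/-- The cells of the hexagonal grid of side length 1, indexed by `ℤ × ℤ`. The index `(u, v)` stands
for the cell with centre `1 + u (1 - ω²) + v (1 - ω)`; so `(1, 0)` is the step to the neighbour in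
direction 30° (up and to the right), `(0, 1)` the step to the neighbour in direction -30° (down and
to the right), and their difference `(1, -1)`, which is `ω - ω²`, the step to the neighbour
straight above. -/
abbrev Cell : Type := ℤ × ℤ

/-- The centre of a cell, a point of the complex plane. -/
def Cell.center (c : Cell) : ℂ :=
  1 + (c.1 : ℂ) * (1 - omega ^ 2) + (c.2 : ℂ) * (1 - omega)

/-- A cell as a subset of the plane: the closed regular hexagon whose vertices are the six points
`center ± ω ^ j`. -/
def Cell.hexagon (c : Cell) : Set ℂ :=
  convexHull ℝ {z | ∃ j : Fin 3, z = Cell.center c + omega ^ (j : ℕ) ∨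
    z = Cell.center c - omega ^ (j : ℕ)}

/-- The closed hexagon with vertices `ω ^ j (a ω + b)` and `-ω ^ j (a + b ω)`. -/
def boundingHexagon (a b : ℕ) : Set ℂ :=
  convexHull ℝ {z | ∃ j : Fin 3, z = omega ^ (j : ℕ) * ((a : ℂ) * omega + (b : ℂ)) ∨
    z = -(omega ^ (j : ℕ) * ((a : ℂ) + (b : ℂ) * omega))}

/-- The `(a, b)`-benzel, given by the set of its cells: those that lie entirely within the
bounding hexagon. -/
def benzel (a b : ℕ) : Set Cell :=
  {c | Cell.hexagon c ⊆ boundingHexagon a b}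

/-- The five prototiles. A stone consists of three pairwise adjacent cells; the left stone has one
cell on the left and two on the right, the right stone one on the right and two on the left. A bone
consists of three consecutive cells with collinear centres. -/
inductive Prototile : Type
  | leftStone
  | rightStone
  | risingBone
  | fallingBone
  | verticalBone

/-- The translate of a prototile whose base cell is `c`. -/
def Prototile.place : Prototile → Cell → Finset Cell
  | .leftStone, c => {c, c + (1, 0), c + (0, 1)}
  | .rightStone, c => {c, c + (1, -1), c + (1, 0)}
  | .risingBone, c => {c, c + (1, 0), c + (2, 0)}
  | .fallingBone, c => {c, c + (0, 1), c + (0, 2)}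
  | .verticalBone, c => {c, c + (1, -1), c + (2, -2)}

/-- `𝒯` is a tiling of the region `R` by translates of prototiles belonging to `P`: every tile in
`𝒯` is such a translate, distinct tiles have no common cell, and the tiles cover exactly `R`. -/
def IsTiling (P : Set Prototile) (R : Set Cell) (𝒯 : Set (Finset Cell)) : Prop :=
  (∀ t ∈ 𝒯, ∃ p ∈ P, ∃ c : Cell, t = Prototile.place p c) ∧
  (∀ t ∈ 𝒯, ∀ t' ∈ 𝒯, t ≠ t' → Disjoint t t') ∧
  (∀ c : Cell, c ∈ R ↔ ∃ t ∈ 𝒯, c ∈ t)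

/-- The number of tilings of `R` by translates of prototiles belonging to `P`. -/
def numTilings (P : Set Prototile) (R : Set Cell) : ℕ :=
  Set.ncard {𝒯 : Set (Finset Cell) | IsTiling P R 𝒯}

/-- Both stones, rising bones and falling bones. -/
def allButVertical : Set Prototile :=
  {Prototile.leftStone, Prototile.rightStone, Prototile.risingBone, Prototile.fallingBone}

/-- The number `T n` of tilings of the `(n + 2, 2n + 1)`-benzel by both stones, rising bones and
falling bones, with the convention `T 0 = 1`. -/
def countT (n : ℕ) : ℕ :=
  if n = 0 then 1 else numTilings allButVertical (benzel (n + 2) (2 * n + 1))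

/-- The number `T' n` of tilings of the `(n + 2, 2n)`-benzel by both stones, rising bones and
falling bones, with the convention `T' 0 = 1`. -/
def countT' (n : ℕ) : ℕ :=
  if n = 0 then 1 else numTilings allButVertical (benzel (n + 2) (2 * n))

end

end HexTiling

/-!
Without vertical bones the tiles are exactly the paths of three cells whose steps are `(1, 0)` and
`(0, -1)` in the indexing of cells, so a tile meets three consecutive columns `u - v = const` in one
cell each (`exists_place_iff`). Number the columns of a benzel from 0 and write `(d, w)` for the
position `w` in column `d`. Then each column is an interval, growing slowly except at the last
columns. Going along the columns from the first one, which is a single cell, a tiling is forced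
except for the position of one cell in each column, the *defect*: the tiles through the defects
start in the columns divisible by 3, and all others in the columns of one other residue `τ` modulo 3 (`Strip`).
Indeed a matching of two consecutive columns by steps of 0 or 1, away from the defect of the first,
is determined by the single cell that it misses in the second, which is the defect there, and this
cell lies weakly on one side of the previous defect (`exists_defectStep_same`,
`exists_defectStep_shift`). Hence path tilings of a strip correspond to the sequences of defects
satisfying local conditions (`Strip.ncard_isPathTiling`).

For the `(n + 2, 2n + 1)`-benzel these conditions say that the defect tile starting in column `3 k`
is at some height `p ≤ k`, rises by `e ∈ {0, 1}` and that the next one starts at a height at least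
`p + e`. Such data are the Schröder paths of size `n` (steps `(1, 0)`, `(0, 1)`, `(1, 1)` weakly
below the diagonal), so `T n` is the large Schröder number `r n`. For the `(n + 2, 2n)`-benzel they
are the same, except that the last defect may not rise from the diagonal; this excludes `r (n - 1)`
paths, whence `T' n = r n - r (n - 1)` (`countT_eq`, `countT'_add`).

Schröder paths are counted by the recurrence for paths to a given endpoint, which by the functional
equation `R = 1 + x R + x R²` is also that of the coefficients of the powers of the Schröder series
(`encard_slotSeqsBelow`). The same equation makes `1 - x - 2 x R` a square root of `1 - 6 x + x²`.
-/

namespace HexTiling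

/-! ### Tilings by lattice paths -/

/-- A path tile in `ℤ × ℤ`, whose points are written `(d, w)` with `d` the column: one cell in each
of three consecutive columns, where `w` is kept or raised by one from a column to the next. -/
def IsPathTile (t : Finset (ℤ × ℤ)) : Prop :=
  ∃ d w i j : ℤ, (i = 0 ∨ i = 1) ∧ (j = 0 ∨ j = 1) ∧
    t = {(d, w), (d + 1, w + i), (d + 2, w + i + j)}

/-- `𝒯` is a tiling of `R` by path tiles. -/
def IsPathTiling (R : Set (ℤ × ℤ)) (𝒯 : Set (Finset (ℤ × ℤ))) : Prop :=
  (∀ t ∈ 𝒯, IsPathTile t) ∧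
  (∀ t ∈ 𝒯, ∀ t' ∈ 𝒯, t ≠ t' → Disjoint t t') ∧
  (∀ c, c ∈ R ↔ ∃ t ∈ 𝒯, c ∈ t)

/-- The local description of a path tiling of `R`: `role c` is the position (0, 1 or 2) of the cell
`c` in its tile, and `next c`, meaningful for cells of role 0 and 1, is the following cell of that
tile. -/
structure IsPathSystem (R : Set (ℤ × ℤ)) (role : ℤ × ℤ → ℤ) (next : ℤ × ℤ → ℤ × ℤ) : Prop where
  role_mem : ∀ c ∈ R, 0 ≤ role c ∧ role c ≤ 2
  next_mem : ∀ c ∈ R, role c < 2 → next c ∈ R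
  role_next : ∀ c ∈ R, role c < 2 → role (next c) = role c + 1
  next_eq : ∀ c ∈ R, role c < 2 → next c = (c.1 + 1, c.2) ∨ next c = (c.1 + 1, c.2 + 1)
  inj : ∀ c ∈ R, ∀ c' ∈ R, role c < 2 → role c' < 2 → next c = next c' → c = c'
  surj : ∀ c ∈ R, 0 < role c → ∃ c' ∈ R, role c' < 2 ∧ next c' = c

/-- The tiles of a path system, one for each cell of role 0. -/
def systemTiles (R : Set (ℤ × ℤ)) (role : ℤ × ℤ → ℤ) (next : ℤ × ℤ → ℤ × ℤ) :
    Set (Finset (ℤ × ℤ)) :=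
  {t | ∃ c ∈ R, role c = 0 ∧ t = {c, next c, next (next c)}}

theorem IsPathSystem.isPathTiling {R : Set (ℤ × ℤ)} {role : ℤ × ℤ → ℤ} {next : ℤ × ℤ → ℤ × ℤ}
    (h : IsPathSystem R role next) : IsPathTiling R (systemTiles R role next) := by
  have key : ∀ c ∈ R, role c = 0 →
      next c ∈ R ∧ role (next c) = 1 ∧ next (next c) ∈ R ∧ role (next (next c)) = 2 := by
    intro c hc h0
    have h1 := h.next_mem c hc (by omega)
    have h2 := h.role_next c hc (by omega)
    have h3 := h.next_mem _ h1 (by omega)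
    have h4 := h.role_next _ h1 (by omega)
    exact ⟨h1, by omega, h3, by omega⟩
  refine ⟨?_, ?_, ?_⟩
  · rintro t ⟨⟨d, w⟩, hc, h0, rfl⟩
    obtain ⟨h1, h2, -, -⟩ := key _ hc h0
    have e1 := h.next_eq _ hc (by omega)
    have e2 := h.next_eq _ h1 (by omega)
    rcases e1 with e1 | e1 <;> rw [e1] at e2 ⊢ <;> rcases e2 with e2 | e2 <;> rw [e2]
    · exact ⟨d, w, 0, 0, by simp, by simp, by simp [add_assoc]⟩
    · exact ⟨d, w, 0, 1, by simp, by simp, by simp [add_assoc]⟩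
    · exact ⟨d, w, 1, 0, by simp, by simp, by simp [add_assoc]⟩
    · exact ⟨d, w, 1, 1, by simp, by simp, by simp [add_assoc]⟩
  · rintro t ⟨c, hc, h0, rfl⟩ t' ⟨c', hc', h0', rfl⟩ hne
    obtain ⟨h1, h2, h3, h4⟩ := key _ hc h0
    obtain ⟨h1', h2', h3', h4'⟩ := key _ hc' h0'
    rw [Finset.disjoint_left]
    intro z hz hz'
    apply hne
    -- the role of the common cell tells its position in either tile
    have : c = c' := by
      simp only [Finset.mem_insert, Finset.mem_singleton] at hz hz'
      rcases hz with rfl | rfl | rfl <;> rcases hz' with hz' | hz' | hz' <;>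
        first
        | exact hz'
        | exact h.inj _ hc _ hc' (by omega) (by omega) hz'
        | exact h.inj _ hc _ hc' (by omega) (by omega)
            (h.inj _ h1 _ h1' (by omega) (by omega) hz')
        | (rw [hz'] at h0; omega)
        | (rw [hz'] at h2; omega)
        | (rw [hz'] at h4; omega)
    rw [this]
  · intro c
    constructor
    · intro hc
      obtain ⟨r0, r2⟩ := h.role_mem c hc
      have : role c = 0 ∨ role c = 1 ∨ role c = 2 := by omega
      rcases this with e | e | e
      · exact ⟨_, ⟨c, hc, e, rfl⟩, by simp⟩
      · obtain ⟨c1, hc1, l1, rfl⟩ := h.surj c hc (by omega)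
        have := h.role_next _ hc1 l1
        exact ⟨_, ⟨c1, hc1, by omega, rfl⟩, by simp⟩
      · obtain ⟨c1, hc1, l1, rfl⟩ := h.surj c hc (by omega)
        have e1 := h.role_next _ hc1 l1
        obtain ⟨c2, hc2, l2, rfl⟩ := h.surj c1 hc1 (by omega)
        have e2 := h.role_next _ hc2 l2
        exact ⟨_, ⟨c2, hc2, by omega, rfl⟩, by simp⟩
    · rintro ⟨t, ⟨c', hc', h0, rfl⟩, hct⟩
      obtain ⟨h1, h2, h3, h4⟩ := key _ hc' h0
      simp only [Finset.mem_insert, Finset.mem_singleton] at hct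
      rcases hct with rfl | rfl | rfl <;> assumption

/-- Every path tiling comes from a path system. -/
theorem IsPathTiling.exists_isPathSystem {R : Set (ℤ × ℤ)} {𝒯 : Set (Finset (ℤ × ℤ))}
    (h : IsPathTiling R 𝒯) :
    ∃ role next, IsPathSystem R role next ∧ 𝒯 = systemTiles R role next := by
  classical
  obtain ⟨htile, hdisj, hcov⟩ := h
  have huniq : ∀ t ∈ 𝒯, ∀ t' ∈ 𝒯, ∀ c, c ∈ t → c ∈ t' → t = t' := by
    intro t ht t' ht' c hc hc'
    by_contra hne
    exact Finset.disjoint_left.1 (hdisj t ht t' ht' hne) hc hc'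
  -- the first cell and the two steps of the tile that covers a given cell
  have hex : ∀ c, ∃ d w i j : ℤ, c ∈ R → (i = 0 ∨ i = 1) ∧ (j = 0 ∨ j = 1) ∧
      ({(d, w), (d + 1, w + i), (d + 2, w + i + j)} : Finset (ℤ × ℤ)) ∈ 𝒯 ∧
      c ∈ ({(d, w), (d + 1, w + i), (d + 2, w + i + j)} : Finset (ℤ × ℤ)) := by
    intro c
    by_cases hc : c ∈ R
    · obtain ⟨t, ht, hct⟩ := (hcov c).1 hc
      obtain ⟨d, w, i, j, hi, hj, rfl⟩ := htile t ht
      exact ⟨d, w, i, j, fun _ => ⟨hi, hj, ht, hct⟩⟩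
    · exact ⟨0, 0, 0, 0, fun h => absurd h hc⟩
  choose d w i j hT using hex
  have hsame : ∀ c ∈ R, ∀ c' ∈ R,
      c' ∈ ({(d c, w c), (d c + 1, w c + i c), (d c + 2, w c + i c + j c)} : Finset (ℤ × ℤ)) →
      d c' = d c ∧ w c' = w c ∧ i c' = i c ∧ j c' = j c := by
    intro c hc c' hc' hm
    obtain ⟨-, -, ht, -⟩ := hT c hc
    obtain ⟨-, -, ht', hc't'⟩ := hT c' hc'
    have e := huniq _ ht' _ ht c' hc't' hm
    have m1 : (d c', w c') ∈ ({(d c, w c), (d c + 1, w c + i c), (d c + 2, w c + i c + j c)} :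
        Finset (ℤ × ℤ)) := by rw [← e]; simp
    have m2 : (d c' + 1, w c' + i c') ∈ ({(d c, w c), (d c + 1, w c + i c),
        (d c + 2, w c + i c + j c)} : Finset (ℤ × ℤ)) := by rw [← e]; simp
    have m3 : (d c' + 2, w c' + i c' + j c') ∈ ({(d c, w c), (d c + 1, w c + i c),
        (d c + 2, w c + i c + j c)} : Finset (ℤ × ℤ)) := by rw [← e]; simp
    simp only [Finset.mem_insert, Finset.mem_singleton, Prod.mk.injEq] at m1 m2 m3
    omega
  have hin : ∀ c ∈ R, ∀ c',
      c' ∈ ({(d c, w c), (d c + 1, w c + i c), (d c + 2, w c + i c + j c)} : Finset (ℤ × ℤ)) →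
      c' ∈ R := fun c hc c' hm => (hcov c').2 ⟨_, (hT c hc).2.2.1, hm⟩
  have hpos : ∀ c ∈ R, c = (d c, w c) ∨ c = (d c + 1, w c + i c) ∨
      c = (d c + 2, w c + i c + j c) := by
    intro c hc
    simpa using (hT c hc).2.2.2
  let role : ℤ × ℤ → ℤ := fun c => c.1 - d c
  let next : ℤ × ℤ → ℤ × ℤ := fun c =>
    if c.1 = d c then (d c + 1, w c + i c) else (d c + 2, w c + i c + j c)
  have hnext : ∀ c ∈ R, next c ∈ ({(d c, w c), (d c + 1, w c + i c),
      (d c + 2, w c + i c + j c)} : Finset (ℤ × ℤ)) := by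
    intro c _
    simp only [next]
    split_ifs <;> simp
  refine ⟨role, next, ⟨?_, ?_, ?_, ?_, ?_, ?_⟩, ?_⟩
  · intro c hc
    simp only [role]
    rcases hpos c hc with e | e | e <;> rw [Prod.ext_iff] at e <;> simp only at e <;> omega
  · exact fun c hc _ => hin c hc _ (hnext c hc)
  · intro c hc hr
    obtain ⟨e, -⟩ := hsame c hc _ (hin c hc _ (hnext c hc)) (hnext c hc)
    simp only [role] at hr ⊢
    rw [e]
    simp only [next]
    rcases hpos c hc with e | e | e <;> rw [Prod.ext_iff] at e <;> simp only at e <;>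
      split_ifs <;> simp only <;> omega
  · intro c hc hr
    obtain ⟨hi, hj, -, -⟩ := hT c hc
    simp only [role] at hr
    simp only [next]
    rcases hpos c hc with e | e | e <;> rw [Prod.ext_iff] at e <;> simp only at e <;>
      split_ifs <;> simp only [Prod.mk.injEq] <;> omega
  · intro c hc c' hc' hr hr' e
    have m := hsame c hc _ (hin c hc _ (hnext c hc)) (hnext c hc)
    have m' := hsame c' hc' _ (hin c' hc' _ (hnext c' hc')) (hnext c' hc')
    rw [← e] at m'
    have q := congrArg Prod.fst e
    simp only [role] at hr hr'
    have p := hpos c hc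
    have p' := hpos c' hc'
    rw [Prod.ext_iff, Prod.ext_iff, Prod.ext_iff] at p p'
    simp only at p p'
    have : (next c).1 = c.1 + 1 := by
      simp only [next]
      split_ifs <;> simp only <;> omega
    have : (next c').1 = c'.1 + 1 := by
      simp only [next]
      split_ifs <;> simp only <;> omega
    rw [Prod.ext_iff]
    omega
  · intro c hc hr
    simp only [role] at hr
    obtain ⟨hi, hj, ht, -⟩ := hT c hc
    have p := hpos c hc
    have go : ∀ c', c' ∈ ({(d c, w c), (d c + 1, w c + i c), (d c + 2, w c + i c + j c)} :
        Finset (ℤ × ℤ)) → c'.1 + 1 = c.1 →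
        (c'.1 = d c ∧ c = (d c + 1, w c + i c) ∨ c'.1 ≠ d c ∧ c = (d c + 2, w c + i c + j c)) →
        ∃ c' ∈ R, role c' < 2 ∧ next c' = c := by
      intro c' hm h1 h2
      have hc' := hin c hc c' hm
      obtain ⟨e1, e2, e3, e4⟩ := hsame c hc c' hc' hm
      refine ⟨c', hc', ?_, ?_⟩
      · simp only [role]
        rw [Prod.ext_iff, Prod.ext_iff, Prod.ext_iff] at p
        simp only at p
        omega
      · simp only [next]
        rw [e1, e2, e3, e4]
        rcases h2 with ⟨h2, h3⟩ | ⟨h2, h3⟩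
        · rw [if_pos h2]; exact h3.symm
        · rw [if_neg h2]; exact h3.symm
    rcases p with e | e | e
    · rw [Prod.ext_iff] at e; simp only at e; omega
    · refine go (d c, w c) (by simp) ?_ (Or.inl ⟨rfl, e⟩)
      rw [Prod.ext_iff] at e; simp only at e ⊢; omega
    · refine go (d c + 1, w c + i c) (by simp) ?_ (Or.inr ⟨by simp, e⟩)
      rw [Prod.ext_iff] at e; simp only at e ⊢; omega
  · have hstart : ∀ c ∈ R, c.1 = d c → ({c, next c, next (next c)} : Finset (ℤ × ℤ)) =
        {(d c, w c), (d c + 1, w c + i c), (d c + 2, w c + i c + j c)} := by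
      intro c hc h0
      obtain ⟨e1, e2, e3, e4⟩ := hsame c hc _ (hin c hc _ (hnext c hc)) (hnext c hc)
      have n1 : next c = (d c + 1, w c + i c) := by simp only [next]; rw [if_pos h0]
      have n2 : next (next c) = (d c + 2, w c + i c + j c) := by
        have : next (next c) = if (next c).1 = d (next c) then
            (d (next c) + 1, w (next c) + i (next c)) else
            (d (next c) + 2, w (next c) + i (next c) + j (next c)) := rfl
        rw [this, e1, e2, e3, e4, if_neg]
        rw [n1]; simp
      have c0 : c = (d c, w c) := by
        have p := hpos c hc
        simp only [Prod.ext_iff] at p ⊢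
        omega
      rw [n2, n1, ← c0]
    ext t
    constructor
    · intro ht
      obtain ⟨d', w', i', j', hi, hj, rfl⟩ := htile t ht
      have hc : (d', w') ∈ R := (hcov _).2 ⟨_, ht, by simp⟩
      have e := huniq _ ht _ (hT _ hc).2.2.1 (d', w') (by simp) (hT _ hc).2.2.2
      have h0 : d' = d (d', w') := by
        have m1 : (d (d', w'), w (d', w')) ∈ ({(d', w'), (d' + 1, w' + i'),
            (d' + 2, w' + i' + j')} : Finset (ℤ × ℤ)) := by rw [e]; simp
        have p := hpos _ hc
        simp only [Finset.mem_insert, Finset.mem_singleton, Prod.mk.injEq] at m1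
        simp only [Prod.ext_iff] at p
        omega
      exact ⟨_, hc, by simp only [role]; omega, by rw [hstart _ hc h0, e]⟩
    · rintro ⟨c, hc, h0, rfl⟩
      rw [hstart c hc (by simp only [role] at h0; omega)]
      exact (hT c hc).2.2.1

/-! ### Matchings of two consecutive columns with one defect -/

/-- The map between consecutive columns that sends the defect `b` of the first to the defect `b'`
of the second, and the other cells of the first to the other cells of the second in increasing
order, each by a step of 0 or 1. When `b' ≤ b` this matches two equal intervals, and when `b < b'`
the second interval is the first one raised by one. -/
def defectStep (b b' w : ℤ) : ℤ :=
  if w = b then b'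
  else if b' ≤ b then (if b' ≤ w ∧ w < b then w + 1 else w)
  else (if b < w ∧ w < b' then w else w + 1)

/-- A matching by steps of 0 or 1 of an interval without the point `b` into the same interval is
determined by the one point `b'` that it misses. -/
theorem exists_defectStep_same {lo hi b : ℤ} {f : ℤ → ℤ} (hb : lo ≤ b ∧ b ≤ hi)
    (hstep : ∀ w, lo ≤ w → w ≤ hi → w ≠ b → f w = w ∨ f w = w + 1)
    (hmem : ∀ w, lo ≤ w → w ≤ hi → w ≠ b → lo ≤ f w ∧ f w ≤ hi)
    (hinj : ∀ w w', lo ≤ w → w ≤ hi → w ≠ b → lo ≤ w' → w' ≤ hi → w' ≠ b → f w = f w' → w = w') :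
    ∃ b', lo ≤ b' ∧ b' ≤ b ∧ ∀ w, lo ≤ w → w ≤ hi → w ≠ b → f w = defectStep b b' w := by
  -- above `b` no step can be raised, by descent from the top
  have habove : ∀ k : ℕ, b < hi - k → f (hi - k) = hi - k := by
    intro k
    induction k with
    | zero =>
      intro h
      have h1 := hstep hi (by omega) (by omega) (by omega)
      have h2 := hmem hi (by omega) (by omega) (by omega)
      simp only [Nat.cast_zero, sub_zero]
      omega
    | succ k ih =>
      intro h
      push_cast at h ⊢
      have h0 := ih (by omega)
      have h1 := hstep (hi - (k + 1)) (by omega) (by omega) (by omega)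
      rcases h1 with h1 | h1
      · exact h1
      · have := hinj (hi - (k + 1)) (hi - k) (by omega) (by omega) (by omega) (by omega)
          (by omega) (by omega) (by omega)
        omega
  -- below `b`, once a step is raised all the following ones are
  have hup : ∀ k : ℕ, ∀ w, lo ≤ w → w + k < b → f w = w + 1 → f (w + k) = w + k + 1 := by
    intro k
    induction k with
    | zero => intro w _ _ h; simpa using h
    | succ k ih =>
      intro w h1 h2 h3
      push_cast at h2 ⊢
      have h4 := ih w h1 (by omega) h3
      rcases hstep (w + (k + 1)) (by omega) (by omega) (by omega) with h5 | h5
      · have := hinj (w + k) (w + (k + 1)) (by omega) (by omega) (by omega) (by omega) (by omega)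
          (by omega) (by omega)
        omega
      · exact h5
  -- the missed point is the lowest one whose step is raised, or `b` itself
  have hex : ∃ k : ℕ, lo + k = b ∨ lo + k < b ∧ f (lo + k) = lo + k + 1 :=
    ⟨(b - lo).toNat, Or.inl (by omega)⟩
  classical
  have hs := Nat.find_spec hex
  have hm : ∀ k : ℕ, k < Nat.find hex → _ := fun k hk => Nat.find_min hex hk
  generalize Nat.find hex = K at hs hm
  refine ⟨lo + K, by omega, by omega, ?_⟩
  intro w h1 h2 h3
  rw [defectStep, if_neg h3, if_pos (by omega)]
  by_cases hw : b < w
  · have := habove (hi - w).toNat (by omega)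
    rw [show hi - ((hi - w).toNat : ℤ) = w by omega] at this
    rw [if_neg (by omega), this]
  · by_cases hK : lo + K ≤ w
    · rw [if_pos (by omega)]
      have := hup (w - (lo + K)).toNat (lo + K) (by omega) (by omega) (by omega)
      rw [show lo + K + ((w - (lo + K)).toNat : ℤ) = w by omega] at this
      exact this
    · rw [if_neg (by omega)]
      have h4 := hm (w - lo).toNat (by omega)
      rw [show lo + ((w - lo).toNat : ℤ) = w by omega] at h4
      have := hstep w h1 h2 h3
      omega

/-- The mirror image of `exists_defectStep_same`, where the target is the interval raised by
one. -/
theorem exists_defectStep_shift {lo hi b : ℤ} {f : ℤ → ℤ} (hb : lo ≤ b ∧ b ≤ hi)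
    (hstep : ∀ w, lo ≤ w → w ≤ hi → w ≠ b → f w = w ∨ f w = w + 1)
    (hmem : ∀ w, lo ≤ w → w ≤ hi → w ≠ b → lo + 1 ≤ f w ∧ f w ≤ hi + 1)
    (hinj : ∀ w w', lo ≤ w → w ≤ hi → w ≠ b → lo ≤ w' → w' ≤ hi → w' ≠ b → f w = f w' → w = w') :
    ∃ b', b < b' ∧ b' ≤ hi + 1 ∧ ∀ w, lo ≤ w → w ≤ hi → w ≠ b → f w = defectStep b b' w := by
  obtain ⟨b', h1, h2, h3⟩ := exists_defectStep_same (lo := -hi) (hi := -lo) (b := -b)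
    (f := fun w => 1 - f (-w)) (by omega)
    (fun w _ _ _ => by have := hstep (-w) (by omega) (by omega) (by omega); omega)
    (fun w _ _ _ => by have := hmem (-w) (by omega) (by omega) (by omega); omega)
    (fun w w' _ _ _ _ _ _ h => by
      have := hinj (-w) (-w') (by omega) (by omega) (by omega) (by omega) (by omega) (by omega)
        (by omega)
      omega)
  refine ⟨1 - b', by omega, by omega, ?_⟩
  intro w h4 h5 h6
  have := h3 (-w) (by omega) (by omega) (by omega)
  simp only [neg_neg, defectStep] at this ⊢
  split_ifs at this ⊢ <;> omega

/-- The following cell in a tile when the defects are at `b`. -/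
def defectNext (b : ℤ → ℤ) (c : ℤ × ℤ) : ℤ × ℤ :=
  (c.1 + 1, defectStep (b c.1) (b (c.1 + 1)) c.2)

/-! ### Strips: regions whose columns are intervals, with a defect in each column -/

/-- A region of `ℤ × ℤ` made of the columns `0, …, N - 1`, column `d` being the interval
`[lo d, hi d]`, from which the point `x d` is removed when `M ≤ d`. In a path tiling, each
column below `M` has exactly one cell, its defect, that lies in a tile starting in a column
divisible by 3; the other cells lie in tiles that start in columns congruent to `τ` modulo 3. From
a column to the next, the interval stays or is raised by one, except where tiles of the second kind
end. -/
structure Strip where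
  (N M τ : ℤ)
  (lo hi x : ℤ → ℤ)
  τ_eq : τ = 1 ∨ τ = 2
  M_pos : 0 < M
  M_le : M ≤ N
  M_mod : M % 3 = 0
  N_mod : (N - τ) % 3 = 0
  N_le : N ≤ M + τ
  lo_zero : lo 0 = hi 0
  x_mem : ∀ d, M ≤ d → d < N → lo d ≤ x d ∧ x d ≤ hi d
  step : ∀ d, 0 ≤ d → d + 1 < N → (d - τ) % 3 ≠ 2 →
    (lo (d + 1) = lo d ∧ hi (d + 1) = hi d) ∨ (lo (d + 1) = lo d + 1 ∧ hi (d + 1) = hi d + 1)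

namespace Strip

variable (S : Strip)

/-- The cells of a strip. -/
def region : Set (ℤ × ℤ) :=
  {c | 0 ≤ c.1 ∧ c.1 < S.N ∧ S.lo c.1 ≤ c.2 ∧ c.2 ≤ S.hi c.1 ∧ (S.M ≤ c.1 → c.2 ≠ S.x c.1)}

/-- The role of a cell when the defects are at `b`. -/
def role (b : ℤ → ℤ) (c : ℤ × ℤ) : ℤ :=
  if c.2 = b c.1 then c.1 % 3 else (c.1 - S.τ) % 3

/-- The conditions on the positions of the defects under which they belong to a path tiling. -/
structure IsDefect (b : ℤ → ℤ) : Prop where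
  mem : ∀ d, 0 ≤ d → d < S.N → S.lo d ≤ b d ∧ b d ≤ S.hi d
  outside : ∀ d, d < 0 ∨ S.M ≤ d → b d = S.x d
  same : ∀ d, 0 ≤ d → d + 1 < S.N → (d - S.τ) % 3 ≠ 2 → S.lo (d + 1) = S.lo d →
    b (d + 1) ≤ b d
  shift : ∀ d, 0 ≤ d → d + 1 < S.N → (d - S.τ) % 3 ≠ 2 → S.lo (d + 1) = S.lo d + 1 →
    b d < b (d + 1)
  link : ∀ d, 0 ≤ d → d + 1 < S.M → d % 3 ≠ 2 → b (d + 1) = b d ∨ b (d + 1) = b d + 1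

/-- The tiling with the given defects. -/
def tiling (b : ℤ → ℤ) : Set (Finset (ℤ × ℤ)) :=
  systemTiles S.region (S.role b) (defectNext b)

variable {S}

theorem role_of_eq {b : ℤ → ℤ} {c : ℤ × ℤ} (h : c.2 = b c.1) : S.role b c = c.1 % 3 :=
  if_pos h

theorem role_of_ne {b : ℤ → ℤ} {c : ℤ × ℤ} (h : c.2 ≠ b c.1) :
    S.role b c = (c.1 - S.τ) % 3 :=
  if_neg h

theorem IsDefect.isPathSystem {b : ℤ → ℤ} (h : S.IsDefect b) :
    IsPathSystem S.region (S.role b) (defectNext b) := by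
  have hτ := S.τ_eq
  have hM := S.M_mod
  have hN := S.N_mod
  have hMN := S.M_le
  have hNM := S.N_le
  have hlo := S.lo_zero
  -- a cell of role below 2 is not in the last column
  have hdlt : ∀ c ∈ S.region, S.role b c < 2 → c.1 + 1 < S.N := by
    rintro ⟨d, w⟩ ⟨h1, h2, h3, h4, h5⟩ hr
    simp only [role] at *
    by_contra hc
    have hd : d = S.N - 1 := by omega
    have ho := h.outside d
    split_ifs at hr with hw
    · have : ¬ S.M ≤ d := fun hm => h5 hm (by rw [hw, ho (Or.inr hm)])
      omega
    · omega
  have hdM : ∀ c ∈ S.region, c.2 = b c.1 → c.1 < S.M := by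
    rintro ⟨d, w⟩ ⟨h1, h2, h3, h4, h5⟩ hw
    have ho := h.outside d
    by_contra hc
    exact h5 (by omega) (by rw [hw]; exact ho (by simp only at hc; omega))
  refine ⟨?_, ?_, ?_, ?_, ?_, ?_⟩
  · intro c _
    simp only [role]
    split_ifs <;> omega
  · rintro ⟨d, w⟩ hc hr
    have hd := hdlt _ hc hr
    have hdm := hdM _ hc
    obtain ⟨h1, h2, h3, h4, h5⟩ := hc
    simp only [role, defectNext, region, Set.mem_ofPred_eq] at *
    have hm := h.mem d h1 h2
    have hm' := h.mem (d + 1) (by omega) hd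
    have hs := S.step d h1 hd
    have h6 := h.same d h1 hd
    have h7 := h.shift d h1 hd
    have ho := h.outside (d + 1)
    by_cases hw : w = b d
    · rw [if_pos hw] at hr
      have := hdm hw
      refine ⟨by omega, hd, ?_, ?_, fun _ => by omega⟩ <;> rw [defectStep, if_pos hw] <;> omega
    · rw [if_neg hw] at hr
      refine ⟨by omega, hd, ?_, ?_, fun hmm => ?_⟩ <;> simp only [defectStep] <;>
        split_ifs <;> omega
  · rintro ⟨d, w⟩ hc hr
    have hd := hdlt _ hc hr
    obtain ⟨h1, h2, h3, h4, h5⟩ := hc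
    have h6 := h.same d h1 hd
    have h7 := h.shift d h1 hd
    have hs := S.step d h1 hd
    by_cases hw : w = b d
    · rw [role_of_eq (c := (d, w)) hw] at hr ⊢
      rw [role_of_eq (by simp [defectNext, defectStep, hw])]
      simp only [defectNext] at *
      omega
    · rw [role_of_ne (c := (d, w)) hw] at hr ⊢
      rw [role_of_ne]
      · simp only [defectNext] at *
        omega
      · simp only [defectNext, defectStep] at *
        split_ifs <;> omega
  · rintro ⟨d, w⟩ hc hr
    have hdm := hdM _ hc
    obtain ⟨h1, h2, h3, h4, h5⟩ := hc
    simp only [role, defectNext, Prod.mk.injEq, true_and] at *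
    by_cases hw : w = b d
    · rw [if_pos hw] at hr
      have := hdm hw
      have := h.link d h1 (by omega) (by omega)
      rw [defectStep, if_pos hw]
      omega
    · simp only [defectStep]
      split_ifs <;> omega
  · rintro ⟨d, w⟩ hc ⟨d', w'⟩ hc' hr hr' e
    simp only [defectNext, Prod.mk.injEq] at e
    obtain ⟨e1, e2⟩ := e
    obtain rfl : d = d' := by omega
    simp only [Prod.mk.injEq, true_and]
    simp only [defectStep] at e2
    split_ifs at e2 <;> omega
  · rintro ⟨d, w⟩ ⟨h1, h2, h3, h4, h5⟩ hr
    simp only [role] at *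
    have hm := h.mem (d - 1)
    have hm' := h.mem d h1 h2
    have hs := S.step (d - 1)
    have h6 := h.same (d - 1)
    have h7 := h.shift (d - 1)
    have h8 := h.link (d - 1)
    have ho := h.outside (d - 1)
    have ho' := h.outside d
    simp only [sub_add_cancel] at hs h6 h7 h8
    -- the column 0 consists of a defect, of role 0
    have hd : 0 < d := by
      rcases eq_or_lt_of_le h1 with rfl | hd
      · rw [if_pos (by omega)] at hr
        omega
      · exact hd
    by_cases hw : w = b d
    · rw [if_pos hw] at hr
      have hdm : d < S.M := by
        by_contra hh
        exact h5 (by omega) (by rw [hw, ho' (by omega)])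
      refine ⟨(d - 1, b (d - 1)), ⟨by omega, by simp only; omega, ?_, ?_, ?_⟩, ?_, ?_⟩
      · simp only; omega
      · simp only; omega
      · simp only; omega
      · simp only [if_true]; omega
      · simp only [defectNext, sub_add_cancel, defectStep, if_true, hw]
    · rw [if_neg hw] at hr
      have hmm := hm (by omega) (by omega)
      have hss := hs (by omega) (by omega) (by omega)
      -- the candidates for the preimage are `w` and `w - 1`
      have : ∃ v, v ≠ b (d - 1) ∧ S.lo (d - 1) ≤ v ∧ v ≤ S.hi (d - 1) ∧
          defectStep (b (d - 1)) (b d) v = w := by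
        by_cases hv : w ≠ b (d - 1) ∧ S.lo (d - 1) ≤ w ∧ w ≤ S.hi (d - 1) ∧
          defectStep (b (d - 1)) (b d) w = w
        · exact ⟨w, hv⟩
        · refine ⟨w - 1, ?_, ?_, ?_, ?_⟩ <;> simp only [defectStep] at hv ⊢ <;>
            split_ifs at hv ⊢ <;> omega
      obtain ⟨v, hv1, hv2, hv3, hv4⟩ := this
      refine ⟨(d - 1, v), ⟨by omega, by simp only; omega, hv2, hv3, ?_⟩, ?_, ?_⟩
      · simp only; intro hmd; rw [← ho (by omega)]; exact hv1
      · simp only [if_neg hv1]; omega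
      · simp only [defectNext, sub_add_cancel, hv4]

theorem IsDefect.isPathTiling {b : ℤ → ℤ} (h : S.IsDefect b) :
    IsPathTiling S.region (S.tiling b) :=
  h.isPathSystem.isPathTiling

end Strip

theorem defectStep_self (b b' : ℤ) : defectStep b b' b = b' := if_pos rfl

theorem defectStep_ne {b b' w : ℤ} (h : w ≠ b) : defectStep b b' w ≠ b' := by
  simp only [defectStep]
  split_ifs <;> omega

namespace Strip

variable {S : Strip}

theorem mem_region {d w : ℤ} : (d, w) ∈ S.region ↔
    0 ≤ d ∧ d < S.N ∧ S.lo d ≤ w ∧ w ≤ S.hi d ∧ (S.M ≤ d → w ≠ S.x d) := Iff.rfl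

/-- In the path system with roles `ρ`, the cell `v` is the defect of column `d`. -/
structure IsColumnDefect (S : Strip) (ρ : ℤ × ℤ → ℤ) (d v : ℤ) : Prop where
  lo_le : S.lo d ≤ v
  le_hi : v ≤ S.hi d
  outside : S.M ≤ d → v = S.x d
  role_eq : (d, v) ∈ S.region → ρ (d, v) = d % 3
  role_ne : ∀ w, (d, w) ∈ S.region → w ≠ v → ρ (d, w) = (d - S.τ) % 3

variable {ρ : ℤ × ℤ → ℤ} {ν : ℤ × ℤ → ℤ × ℤ}

theorem IsColumnDefect.mem {d v : ℤ} (h : S.IsColumnDefect ρ d v) (hd : 0 ≤ d) (hM : d < S.M) :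
    (d, v) ∈ S.region :=
  ⟨hd, hM.trans_le S.M_le, h.lo_le, h.le_hi, fun h' => absurd h' (by simp only; omega)⟩

theorem IsColumnDefect.unique {d v v' : ℤ} (hd : 0 ≤ d) (h : S.IsColumnDefect ρ d v)
    (h' : S.IsColumnDefect ρ d v') : v = v' := by
  rcases lt_or_ge d S.M with hM | hM
  · by_contra hne
    have h1 := h.role_eq (h.mem hd hM)
    have h2 := h'.role_ne v (h.mem hd hM) hne
    have := S.τ_eq
    omega
  · rw [h.outside hM, h'.outside hM]

theorem isColumnDefect_zero (hP : IsPathSystem S.region ρ ν) : S.IsColumnDefect ρ 0 (S.lo 0) := by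
  have hM := S.M_pos
  have h0 := S.lo_zero
  refine ⟨le_rfl, h0.le, fun h => by omega, ?_, ?_⟩
  · intro h
    have h1 := hP.role_mem _ h
    by_contra h2
    obtain ⟨⟨d, w⟩, h3, h4, h5⟩ := hP.surj _ h (by omega)
    have h6 := hP.next_eq _ h3 h4
    rw [h5] at h6
    have := h3.1
    simp only [Prod.mk.injEq] at h6 this
    omega
  · intro w h1 h2
    rw [mem_region] at h1
    omega

/-- The propagation of the defect from a column to the next. -/
theorem IsColumnDefect.succ (hP : IsPathSystem S.region ρ ν) {d v : ℤ} (hd : 0 ≤ d)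
    (hN : d + 1 < S.N) (h : S.IsColumnDefect ρ d v) :
    ∃ v', S.IsColumnDefect ρ (d + 1) v' ∧
      ((d - S.τ) % 3 ≠ 2 → S.lo (d + 1) = S.lo d → v' ≤ v) ∧
      ((d - S.τ) % 3 ≠ 2 → S.lo (d + 1) = S.lo d + 1 → v < v') ∧
      (d + 1 < S.M → d % 3 ≠ 2 → v' = v ∨ v' = v + 1) ∧
      ∀ w, (d, w) ∈ S.region → ρ (d, w) < 2 → ν (d, w) = (d + 1, defectStep v v' w) := by
  have hτ := S.τ_eq
  have hMm := S.M_mod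
  have hNm := S.N_mod
  have hMN := S.M_le
  have hNM := S.N_le
  have hmem : ∀ w, S.lo d ≤ w → w ≤ S.hi d → w ≠ v → (d, w) ∈ S.region := fun w h1 h2 h3 =>
    ⟨hd, by simp only; omega, h1, h2, fun hM => by rw [← h.outside hM]; exact h3⟩
  -- the cells of the next column with positive role come from column `d`
  have hpre : ∀ w', (d + 1, w') ∈ S.region → 0 < ρ (d + 1, w') →
      ∃ w, (d, w) ∈ S.region ∧ ρ (d, w) < 2 ∧ ν (d, w) = (d + 1, w') := by
    intro w' h1 h2
    obtain ⟨⟨d', w⟩, h3, h4, h5⟩ := hP.surj _ h1 h2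
    have h6 := hP.next_eq _ h3 h4
    rw [h5] at h6
    simp only [Prod.mk.injEq] at h6
    obtain rfl : d = d' := by omega
    exact ⟨w, h3, h4, h5⟩
  have hAB : (d - S.τ) % 3 = 2 → d + 1 < S.M ∧ d % 3 ≠ 2 := by omega
  -- the next cell of a defect of role below 2
  have hB : d + 1 < S.M → d % 3 ≠ 2 → ∃ y, (y = v ∨ y = v + 1) ∧ ν (d, v) = (d + 1, y) ∧
      (d + 1, y) ∈ S.region ∧ ρ (d + 1, y) = (d + 1) % 3 := by
    intro h1 h2
    have h3 := h.mem hd (by omega)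
    have h4 := h.role_eq h3
    have h5 := hP.next_mem _ h3 (by omega)
    have h6 := hP.role_next _ h3 (by omega)
    rcases hP.next_eq _ h3 (by omega) with h7 | h7 <;> rw [h7] at h5 h6 <;>
      dsimp only at h5 h6 h7
    · exact ⟨v, Or.inl rfl, h7, h5, by omega⟩
    · exact ⟨v + 1, Or.inr rfl, h7, h5, by omega⟩
  by_cases hA : (d - S.τ) % 3 = 2
  · -- a new family of tiles starts in the next column, outside its defect
    have hc := hAB hA
    obtain ⟨v', h1, h2, h3, h4⟩ := hB hc.1 hc.2
    refine ⟨v', ⟨h3.2.2.1, h3.2.2.2.1, fun _ => by omega, fun _ => h4, ?_⟩, fun h => absurd hA h,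
      fun h => absurd hA h, fun _ _ => h1, ?_⟩
    · intro w' h5 h6
      have h7 := hP.role_mem _ h5
      by_contra h8
      obtain ⟨w, h9, h10, h11⟩ := hpre w' h5 (by omega)
      by_cases hw : w = v
      · rw [hw, h2, Prod.mk.injEq] at h11
        exact h6 h11.2.symm
      · have := h.role_ne w h9 hw
        omega
    · intro w h5 h6
      by_cases hw : w = v
      · rw [hw, h2, defectStep_self]
      · have := h.role_ne w h5 hw
        omega
  · have hf : ∀ w, S.lo d ≤ w → w ≤ S.hi d → w ≠ v → ∃ y, (y = w ∨ y = w + 1) ∧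
        ν (d, w) = (d + 1, y) ∧ (d + 1, y) ∈ S.region ∧ ρ (d + 1, y) = (d + 1 - S.τ) % 3 := by
      intro w h1 h2 h3
      have h4 := hmem w h1 h2 h3
      have h5 := h.role_ne w h4 h3
      have h6 := hP.next_mem _ h4 (by omega)
      have h7 := hP.role_next _ h4 (by omega)
      rcases hP.next_eq _ h4 (by omega) with h8 | h8 <;> rw [h8] at h6 h7 <;>
        dsimp only at h6 h7 h8
      · exact ⟨w, Or.inl rfl, h8, h6, by omega⟩
      · exact ⟨w + 1, Or.inr rfl, h8, h6, by omega⟩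
    have hstep : ∀ w, S.lo d ≤ w → w ≤ S.hi d → w ≠ v →
        (ν (d, w)).2 = w ∨ (ν (d, w)).2 = w + 1 := by
      intro w h1 h2 h3
      obtain ⟨y, h4, h5, -⟩ := hf w h1 h2 h3
      rw [h5]; exact h4
    have hrange : ∀ w, S.lo d ≤ w → w ≤ S.hi d → w ≠ v →
        S.lo (d + 1) ≤ (ν (d, w)).2 ∧ (ν (d, w)).2 ≤ S.hi (d + 1) := by
      intro w h1 h2 h3
      obtain ⟨y, h4, h5, h6, -⟩ := hf w h1 h2 h3
      rw [h5]; exact ⟨h6.2.2.1, h6.2.2.2.1⟩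
    have hinj : ∀ w w', S.lo d ≤ w → w ≤ S.hi d → w ≠ v → S.lo d ≤ w' → w' ≤ S.hi d → w' ≠ v →
        (ν (d, w)).2 = (ν (d, w')).2 → w = w' := by
      intro w w' h1 h2 h3 h1' h2' h3' e
      obtain ⟨y, -, h5, -⟩ := hf w h1 h2 h3
      obtain ⟨y', -, h5', -⟩ := hf w' h1' h2' h3'
      have r := h.role_ne w (hmem w h1 h2 h3) h3
      have r' := h.role_ne w' (hmem w' h1' h2' h3') h3'
      have := hP.inj _ (hmem w h1 h2 h3) _ (hmem w' h1' h2' h3') (by omega) (by omega)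
        (by rw [h5, h5'] at e ⊢; simpa using e)
      simpa using this
    have hs := S.step d hd hN hA
    -- the cell `v'` missed by the tiles of the second kind
    obtain ⟨v', hlo, hhi, hsame, hshift, hv'⟩ : ∃ v', S.lo (d + 1) ≤ v' ∧ v' ≤ S.hi (d + 1) ∧
        (S.lo (d + 1) = S.lo d → v' ≤ v) ∧ (S.lo (d + 1) = S.lo d + 1 → v < v') ∧
        ∀ w, S.lo d ≤ w → w ≤ S.hi d → w ≠ v → (ν (d, w)).2 = defectStep v v' w := by
      have hv : S.lo d ≤ v ∧ v ≤ S.hi d := ⟨h.lo_le, h.le_hi⟩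
      rcases hs with ⟨s1, s2⟩ | ⟨s1, s2⟩ <;> rw [s1, s2] at hrange
      · obtain ⟨v', h1, h2, h3⟩ := exists_defectStep_same hv hstep hrange hinj
        exact ⟨v', by omega, by omega, fun _ => h2, fun _ => by omega, h3⟩
      · obtain ⟨v', h1, h2, h3⟩ := exists_defectStep_shift hv hstep hrange hinj
        exact ⟨v', by omega, by omega, fun _ => by omega, fun _ => h1, h3⟩
    have hlo' := h.lo_le
    have hhi' := h.le_hi
    have hsurj : ∀ w', S.lo (d + 1) ≤ w' → w' ≤ S.hi (d + 1) → w' ≠ v' →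
        ∃ w, S.lo d ≤ w ∧ w ≤ S.hi d ∧ w ≠ v ∧ ν (d, w) = (d + 1, w') ∧
          (d + 1, w') ∈ S.region ∧ ρ (d + 1, w') = (d + 1 - S.τ) % 3 := by
      intro w' h1 h2 h3
      obtain ⟨w, h4, h5, h6, h7⟩ : ∃ w, S.lo d ≤ w ∧ w ≤ S.hi d ∧ w ≠ v ∧
          defectStep v v' w = w' := by
        by_cases hc : S.lo d ≤ w' ∧ w' ≤ S.hi d ∧ w' ≠ v ∧ defectStep v v' w' = w'
        · exact ⟨w', hc⟩
        · refine ⟨w' - 1, ?_, ?_, ?_, ?_⟩ <;> simp only [defectStep] at hc ⊢ <;>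
            split_ifs at hc ⊢ <;> omega
      obtain ⟨y, -, h8, h9, h10⟩ := hf w h4 h5 h6
      have h11 := hv' w h4 h5 h6
      rw [h8, h7] at h11
      simp only at h11
      rw [h11] at h8 h9 h10
      exact ⟨w, h4, h5, h6, h8, h9, h10⟩
    have hout : S.M ≤ d + 1 → v' = S.x (d + 1) := by
      intro hM
      obtain ⟨x1, x2⟩ := S.x_mem (d + 1) hM hN
      by_contra hne
      obtain ⟨w, -, -, -, -, h1, -⟩ := hsurj _ x1 x2 (Ne.symm hne)
      exact h1.2.2.2.2 hM rfl
    have hBv : d + 1 < S.M → d % 3 ≠ 2 → ν (d, v) = (d + 1, v') := by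
      intro h1 h2
      obtain ⟨y, -, h3, h4, -⟩ := hB h1 h2
      by_cases hy : y = v'
      · rw [h3, hy]
      · obtain ⟨w, h5, h6, h7, h8, -⟩ := hsurj y h4.2.2.1 h4.2.2.2.1 hy
        have r := h.role_ne w (hmem w h5 h6 h7) h7
        have hvm := h.mem hd (by omega)
        have r' := h.role_eq hvm
        have := hP.inj _ (hmem w h5 h6 h7) _ hvm (by omega) (by omega) (by rw [h8, h3])
        exact absurd (Prod.mk.inj this).2 h7
    refine ⟨v', ⟨hlo, hhi, hout, ?_, ?_⟩, fun _ => hsame, fun _ => hshift, ?_, ?_⟩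
    · intro hm
      have hM : d + 1 < S.M := by
        by_contra hM
        exact hm.2.2.2.2 (by simp only; omega) (hout (by omega))
      by_cases hd3 : d % 3 = 2
      · have h7 := hP.role_mem _ hm
        by_contra h8
        obtain ⟨w, h9, h10, h11⟩ := hpre v' hm (by omega)
        by_cases hw : w = v
        · rw [hw] at h9 h10
          have := h.role_eq h9
          omega
        · have := hv' w h9.2.2.1 h9.2.2.2.1 hw
          rw [h11] at this
          exact defectStep_ne hw this.symm
      · obtain ⟨y, -, h3, -, h4⟩ := hB hM hd3
        rw [hBv hM hd3, Prod.mk.injEq] at h3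
        rw [h3.2, h4]
    · intro w' h1 h2
      obtain ⟨w, -, -, -, -, -, h3⟩ := hsurj w' h1.2.2.1 h1.2.2.2.1 h2
      exact h3
    · intro h1 h2
      obtain ⟨y, h3, h4, -⟩ := hB h1 h2
      rw [hBv h1 h2, Prod.mk.injEq] at h4
      rw [h4.2]; exact h3
    · intro w h1 h2
      by_cases hw : w = v
      · subst hw
        have hM : d < S.M := by
          by_contra hM
          exact h1.2.2.2.2 (by simp only; omega) (h.outside (by omega))
        have := h.role_eq h1
        rw [defectStep_self, hBv (by omega) (by omega)]
      · obtain ⟨y, -, h3, -⟩ := hf w h1.2.2.1 h1.2.2.2.1 hw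
        have := hv' w h1.2.2.1 h1.2.2.2.1 hw
        rw [h3] at this ⊢
        rw [← this]

/-- Every path tiling of a strip is determined by its defects. -/
theorem exists_isDefect {𝒯 : Set (Finset (ℤ × ℤ))} (h : IsPathTiling S.region 𝒯) :
    ∃ b, S.IsDefect b ∧ 𝒯 = S.tiling b := by
  obtain ⟨ρ, ν, hP, rfl⟩ := h.exists_isPathSystem
  have hex : ∀ d, 0 ≤ d → d < S.N → ∃ v, S.IsColumnDefect ρ d v := by
    intro d hd
    induction d, hd using Int.leInduction with
    | base => exact fun _ => ⟨_, isColumnDefect_zero hP⟩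
    | succ d hd ih =>
      intro hN
      obtain ⟨v, hv⟩ := ih (by omega)
      obtain ⟨v', hv', -⟩ := hv.succ hP hd hN
      exact ⟨v', hv'⟩
  choose! a ha using hex
  let b : ℤ → ℤ := fun d => if 0 ≤ d ∧ d < S.M then a d else S.x d
  have hb : ∀ d, 0 ≤ d → d < S.N → S.IsColumnDefect ρ d (b d) := by
    intro d h1 h2
    have h3 := ha d h1 h2
    simp only [b]
    split_ifs with hc
    · exact h3
    · rwa [← h3.outside (by omega)]
  have hsucc : ∀ d, 0 ≤ d → d + 1 < S.N →
      ((d - S.τ) % 3 ≠ 2 → S.lo (d + 1) = S.lo d → b (d + 1) ≤ b d) ∧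
      ((d - S.τ) % 3 ≠ 2 → S.lo (d + 1) = S.lo d + 1 → b d < b (d + 1)) ∧
      (d + 1 < S.M → d % 3 ≠ 2 → b (d + 1) = b d ∨ b (d + 1) = b d + 1) ∧
      ∀ w, (d, w) ∈ S.region → ρ (d, w) < 2 →
        ν (d, w) = (d + 1, defectStep (b d) (b (d + 1)) w) := by
    intro d h1 h2
    obtain ⟨v', h3, h4⟩ := (hb d h1 (by omega)).succ hP h1 h2
    rw [h3.unique (by omega) (hb (d + 1) (by omega) h2)] at h4
    exact h4
  have hrole : ∀ c ∈ S.region, ρ c = S.role b c := by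
    rintro ⟨d, w⟩ hc
    have h1 := hb d hc.1 hc.2.1
    by_cases hw : w = b d
    · rw [role_of_eq (c := (d, w)) hw, hw]
      exact h1.role_eq (hw ▸ hc)
    · rw [role_of_ne (c := (d, w)) hw]
      exact h1.role_ne w hc hw
  have hdef : S.IsDefect b := by
    refine ⟨?_, ?_, ?_, ?_, ?_⟩
    · exact fun d h1 h2 => ⟨(hb d h1 h2).lo_le, (hb d h1 h2).le_hi⟩
    · intro d hd
      exact if_neg (by omega)
    · exact fun d h1 h2 => (hsucc d h1 h2).1
    · exact fun d h1 h2 => (hsucc d h1 h2).2.1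
    · exact fun d h1 h2 => (hsucc d h1 (by have := S.M_le; omega)).2.2.1 h2
  have hnext : ∀ c ∈ S.region, ρ c < 2 → ν c = defectNext b c := by
    rintro ⟨d, w⟩ hc hr
    have h1 := hP.next_mem _ hc hr
    have h2 := hP.next_eq _ hc hr
    have h3 : (ν (d, w)).1 = d + 1 := by
      rcases h2 with h2 | h2 <;> rw [h2]
    exact (hsucc d hc.1 (by have := h1.2.1; omega)).2.2.2 w hc hr
  refine ⟨b, hdef, ?_⟩
  ext t
  have key : ∀ c ∈ S.region, ρ c = 0 → ({c, ν c, ν (ν c)} : Finset (ℤ × ℤ)) =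
      {c, defectNext b c, defectNext b (defectNext b c)} := by
    intro c hc h0
    rw [hnext _ (hP.next_mem c hc (by omega)) (by rw [hP.role_next c hc (by omega)]; omega),
      hnext c hc (by omega)]
  constructor
  · rintro ⟨c, hc, h0, rfl⟩
    exact ⟨c, hc, by rw [← hrole c hc, h0], key c hc h0⟩
  · rintro ⟨c, hc, h0, rfl⟩
    rw [← hrole c hc] at h0
    exact ⟨c, hc, h0, (key c hc h0).symm⟩

/-- The defects can be read off from the tiling. -/
theorem IsDefect.tiling_injective {b b' : ℤ → ℤ} (h : S.IsDefect b) (h' : S.IsDefect b')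
    (e : S.tiling b = S.tiling b') : b = b' := by
  -- a tile that starts at a defect of `b` also starts at a defect of `b'`
  have hM := S.M_le
  have hMm := S.M_mod
  have hτ := S.τ_eq
  have hrow : ∀ d, 0 ≤ d → d < S.M → d % 3 = 0 →
      b d = b' d ∧ b (d + 1) = b' (d + 1) ∧ b (d + 2) = b' (d + 2) := by
    intro d h1 h2 h3
    have hm := h.mem d h1 (by omega)
    have hmem : ({(d, b d), defectNext b (d, b d), defectNext b (defectNext b (d, b d))} :
        Finset (ℤ × ℤ)) ∈ S.tiling b' := by
      rw [← e]
      refine ⟨(d, b d), ⟨h1, by simp only; omega, hm.1, hm.2, fun _ => by omega⟩, ?_, rfl⟩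
      rw [role_of_eq rfl]
      exact h3
    obtain ⟨⟨d', w⟩, hc, h0, h4⟩ := hmem
    have e1 : (d, b d) ∈ ({(d', w), defectNext b' (d', w), defectNext b' (defectNext b' (d', w))} :
        Finset (ℤ × ℤ)) := by rw [← h4]; simp
    have e2 : (d + 1, b (d + 1)) ∈ ({(d', w), defectNext b' (d', w),
        defectNext b' (defectNext b' (d', w))} : Finset (ℤ × ℤ)) := by
      rw [← h4]; simp [defectNext, defectStep_self]
    have e3 : (d + 2, b (d + 2)) ∈ ({(d', w), defectNext b' (d', w),
        defectNext b' (defectNext b' (d', w))} : Finset (ℤ × ℤ)) := by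
      rw [← h4]; simp [defectNext, defectStep_self, add_assoc]
    simp only [defectNext, Finset.mem_insert, Finset.mem_singleton, Prod.mk.injEq] at e1 e2 e3
    obtain rfl : d = d' := by omega
    have hw : w = b' d := by
      by_contra hw
      rw [role_of_ne (c := (d, w)) hw] at h0
      simp only at h0
      omega
    subst hw
    simp only [defectStep_self, show d + 1 + 1 = d + 2 by ring] at e1 e2 e3
    omega
  funext d
  by_cases hd : 0 ≤ d ∧ d < S.M
  · obtain ⟨h1, h2, h3⟩ := hrow (d - d % 3) (by omega) (by omega) (by omega)
    have : d % 3 = 0 ∨ d % 3 = 1 ∨ d % 3 = 2 := by omega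
    rcases this with r | r | r <;> rw [r] at h1 h2 h3
    · simpa using h1
    · simpa using h2
    · simpa using h3
  · rw [h.outside d (by omega), h'.outside d (by omega)]

theorem ncard_isPathTiling (S : Strip) :
    Set.ncard {𝒯 | IsPathTiling S.region 𝒯} = Set.ncard {b | S.IsDefect b} := by
  symm
  refine Set.ncard_congr (fun b _ => S.tiling b) ?_ ?_ ?_
  · exact fun b hb => hb.isPathTiling
  · exact fun b b' hb hb' e => hb.tiling_injective hb' e
  · intro 𝒯 h
    obtain ⟨b, hb, rfl⟩ := exists_isDefect h
    exact ⟨b, hb, rfl⟩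

end Strip

/-! ### The two strips and their slot sequences -/

/-- A slot sequence of length `n` encodes a Schröder path, that is a lattice path with steps
`(1, 0)`, `(0, 1)` and `(1, 1)` that stays weakly below the diagonal, up to its last horizontal or
diagonal step: `s k = 2 * p + e` when its step from abscissa `k` to `k + 1` starts at height `p`
and rises by `e`. The values of `s` from `n` on are set to 0. -/
structure IsSlotSeq (n : ℕ) (s : ℕ → ℕ) : Prop where
  le : ∀ k < n, s k ≤ 2 * k + 1
  mono : ∀ k, k + 1 < n → s k + s k % 2 ≤ s (k + 1)
  zero : ∀ k, n ≤ k → s k = 0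

/-- The defects attached to a slot sequence `s`: in the columns `3 k`, `3 k + 1`, `3 k + 2`, the
defect has height `p` above level `k` before column `3 k + τ`, and `p + e` from that column on,
where `s k = 2 * p + e`. When `τ = 1` the whole column `3 n - 1`, the last one with a defect, is
raised by one. Outside the columns `0, …, 3 n - 1` the value is that of `x`. -/
def slotDefect (n : ℕ) (τ : ℤ) (x : ℤ → ℤ) (s : ℕ → ℕ) (d : ℤ) : ℤ :=
  if 0 ≤ d ∧ d < 3 * n then
    d / 3 + (s (d / 3).toNat : ℤ) / 2 + (if τ ≤ d % 3 then (s (d / 3).toNat : ℤ) % 2 else 0) +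
      (if τ = 1 ∧ d = 3 * n - 1 then 1 else 0)
  else x d

theorem slotDefect_of_lt {n : ℕ} {τ : ℤ} {x : ℤ → ℤ} {s : ℕ → ℕ} {k : ℕ} {d i : ℤ} (hk : k < n)
    (hi : 0 ≤ i) (hi' : i < 3) (hd : d = 3 * k + i) :
    slotDefect n τ x s d = k + (s k : ℤ) / 2 + (if τ ≤ i then (s k : ℤ) % 2 else 0) +
      (if τ = 1 ∧ d = 3 * n - 1 then 1 else 0) := by
  rw [slotDefect, if_pos (by omega), show d / 3 = k by omega, show d % 3 = i by omega,
    Int.toNat_natCast]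

theorem slotDefect_injective {n : ℕ} {τ : ℤ} {x : ℤ → ℤ} {s s' : ℕ → ℕ} (hτ : τ = 1 ∨ τ = 2)
    (hs : IsSlotSeq n s) (hs' : IsSlotSeq n s') (h : slotDefect n τ x s = slotDefect n τ x s') :
    s = s' := by
  funext k
  by_cases hk : k < n
  · have h0 := congrFun h (3 * k)
    have h2 := congrFun h (3 * k + 2)
    rw [slotDefect_of_lt hk (i := 0) le_rfl (by omega) (by omega),
      slotDefect_of_lt hk (i := 0) le_rfl (by omega) (by omega)] at h0
    rw [slotDefect_of_lt hk (i := 2) (by omega) (by omega) (by omega),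
      slotDefect_of_lt hk (i := 2) (by omega) (by omega) (by omega)] at h2
    rcases hτ with rfl | rfl <;> split_ifs at h0 h2 <;> omega
  · rw [hs.zero k (by omega), hs'.zero k (by omega)]

/-- The strip of the `(n + 2, 2n + 1)`-benzel. -/
def oddStrip (n : ℕ) (hn : 1 ≤ n) : Strip where
  N := 3 * n + 2
  M := 3 * n
  τ := 2
  lo d := d / 3
  hi d := 2 * d / 3
  x d := if d = 3 * n then 2 * n else n
  τ_eq := Or.inr rfl
  M_pos := by omega
  M_le := by omega
  M_mod := by omega
  N_mod := by omega
  N_le := by omega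
  lo_zero := by omega
  x_mem d h1 h2 := by split_ifs <;> omega
  step d h1 h2 h3 := by
    have : d % 3 = 0 ∨ d % 3 = 2 := by omega
    rcases this with h | h <;> omega

/-- The strip of the `(n + 2, 2n)`-benzel. -/
def evenStrip (n : ℕ) (hn : 1 ≤ n) : Strip where
  N := 3 * n + 1
  M := 3 * n
  τ := 1
  lo d := if d = 3 * n - 1 then n else d / 3
  hi d := if d < 3 * n - 2 then (2 * d + 1) / 3 else if d = 3 * n - 2 then 2 * n - 2 else 2 * n - 1
  x _ := n
  τ_eq := Or.inl rfl
  M_pos := by omega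
  M_le := by omega
  M_mod := by omega
  N_mod := by omega
  N_le := by omega
  lo_zero := by split_ifs <;> omega
  x_mem d h1 h2 := by split_ifs <;> omega
  step d h1 h2 h3 := by
    have : d % 3 = 1 ∨ d % 3 = 2 := by omega
    rcases this with h | h <;> split_ifs <;> omega

theorem ncard_oddStrip (n : ℕ) (hn : 1 ≤ n) :
    Set.ncard {b | (oddStrip n hn).IsDefect b} = Set.ncard {s | IsSlotSeq n s} := by
  symm
  refine Set.ncard_congr (fun s _ => slotDefect n 2 (oddStrip n hn).x s) ?_ ?_ ?_
  · intro s hs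
    refine ⟨?_, ?_, ?_, ?_, ?_⟩
    all_goals
      simp only [oddStrip, slotDefect]
      intro d
    · intro h1 h2
      have hk : ((d / 3).toNat : ℤ) = d / 3 := by omega
      generalize (d / 3).toNat = k at hk ⊢
      have h3 := hs.le k
      split_ifs <;> omega
    · intro h
      rw [if_neg (by omega)]
    · intro h1 h2 h3 h4
      have hk : ((d / 3).toNat : ℤ) = d / 3 := by omega
      rw [show ((d + 1) / 3) = d / 3 by omega]
      generalize (d / 3).toNat = k at hk ⊢
      have h5 := hs.le k
      split_ifs <;> omega
    · intro h1 h2 h3 h4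
      have hk : ((d / 3).toNat : ℤ) = d / 3 := by omega
      rw [show ((d + 1) / 3).toNat = (d / 3).toNat + 1 by omega]
      generalize (d / 3).toNat = k at hk ⊢
      have h5 := hs.le k
      have h6 := hs.mono k
      split_ifs <;> omega
    · intro h1 h2 h3
      have hk : ((d / 3).toNat : ℤ) = d / 3 := by omega
      rw [show ((d + 1) / 3) = d / 3 by omega]
      generalize (d / 3).toNat = k at hk ⊢
      split_ifs <;> omega
  · exact fun s s' hs hs' => slotDefect_injective (Or.inr rfl) hs hs'
  · intro b hb
    have hm := hb.mem
    have ho := hb.outside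
    have hsame := hb.same
    have hshift := hb.shift
    have hlink := hb.link
    simp only [oddStrip] at hm ho hsame hshift hlink
    -- the heights of the three defects of a tile
    have hrow : ∀ k : ℕ, k < n → (k : ℤ) ≤ b (3 * k) ∧ b (3 * k) ≤ 2 * k ∧
        b (3 * k + 1) = b (3 * k) ∧ (b (3 * k + 2) = b (3 * k) ∨ b (3 * k + 2) = b (3 * k) + 1) ∧
        (k + 1 < n → b (3 * k + 2) < b (3 * (k + 1 : ℕ))) := by
      intro k hk
      have h1 := hm (3 * k) (by omega) (by omega)
      have h2 := hsame (3 * k) (by omega) (by omega) (by omega) (by omega)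
      have h3 := hlink (3 * k) (by omega) (by omega) (by omega)
      have h4 := hlink (3 * k + 1) (by omega) (by omega) (by omega)
      have h5 := hshift (3 * k + 2) (by omega) (by omega) (by omega) (by omega)
      rw [show (3 * k + 1 + 1 : ℤ) = 3 * k + 2 by ring] at h4
      rw [show (3 * k + 2 + 1 : ℤ) = 3 * (k + 1 : ℕ) by push_cast; ring] at h5
      omega
    refine ⟨fun k => if k < n then (b (3 * k) - k + (b (3 * k + 2) - k)).toNat else 0,
      ⟨?_, ?_, ?_⟩, ?_⟩
    · intro k hk
      have := hrow k hk
      rw [if_pos hk]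
      omega
    · intro k hk
      have h1 := hrow k (by omega)
      have h2 := hrow (k + 1) hk
      rw [if_pos (by omega), if_pos hk]
      omega
    · intro k hk
      rw [if_neg (by omega)]
    · funext d
      by_cases hd : 0 ≤ d ∧ d < 3 * n
      · obtain ⟨k, hk⟩ : ∃ k : ℕ, (k : ℤ) = d / 3 := ⟨(d / 3).toNat, by omega⟩
        have hkn : k < n := by omega
        have := hrow k hkn
        rw [slotDefect_of_lt hkn (i := d % 3) (by omega) (by omega) (by omega), if_pos hkn]
        have : d = 3 * k ∨ d = 3 * k + 1 ∨ d = 3 * k + 2 := by omega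
        rcases this with rfl | rfl | rfl <;> split_ifs <;> omega
      · rw [slotDefect, if_neg hd, ho d (by omega)]
        rfl

theorem ncard_evenStrip (n : ℕ) (hn : 1 ≤ n) :
    Set.ncard {b | (evenStrip n hn).IsDefect b} =
      Set.ncard {s | IsSlotSeq n s ∧ s (n - 1) ≠ 2 * n - 1} := by
  symm
  refine Set.ncard_congr (fun s _ => slotDefect n 1 (evenStrip n hn).x s) ?_ ?_ ?_
  · rintro s ⟨hs, hlast⟩
    refine ⟨?_, ?_, ?_, ?_, ?_⟩
    all_goals
      simp only [evenStrip, slotDefect, true_and]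
      intro d
    · intro h1 h2
      have hk : ((d / 3).toNat : ℤ) = d / 3 := by omega
      generalize (d / 3).toNat = k at hk ⊢
      have h3 := hs.le k
      have h4 : k = n - 1 → s k ≠ 2 * n - 1 := fun h => h ▸ hlast
      split_ifs <;> omega
    · intro h
      rw [if_neg (by omega)]
    · intro h1 h2 h3 h4
      have hk : ((d / 3).toNat : ℤ) = d / 3 := by omega
      have hk' : ((d + 1) / 3).toNat = (d / 3).toNat ∨ d + 1 = 3 * n := by
        split_ifs at h4 <;> omega
      rcases hk' with hk' | hk'
      · rw [hk']
        generalize (d / 3).toNat = k at hk ⊢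
        have h5 := hs.le k
        split_ifs at h4 ⊢ <;> omega
      · rw [if_neg (by omega)]
        split_ifs <;> omega
    · intro h1 h2 h3 h4
      have hk : ((d / 3).toNat : ℤ) = d / 3 := by omega
      have hk' : ((d + 1) / 3).toNat = (d / 3).toNat + 1 ∨
          ((d + 1) / 3).toNat = (d / 3).toNat ∧ d + 2 = 3 * n := by
        split_ifs at h4 <;> omega
      rcases hk' with hk' | ⟨hk', -⟩
      · rw [hk']
        generalize (d / 3).toNat = k at hk ⊢
        have h5 := hs.le k
        have h6 := hs.mono k
        split_ifs at h4 ⊢ <;> omega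
      · rw [hk']
        generalize (d / 3).toNat = k at hk ⊢
        split_ifs at h4 ⊢ <;> omega
    · intro h1 h2 h3
      have hk : ((d / 3).toNat : ℤ) = d / 3 := by omega
      rw [show ((d + 1) / 3) = d / 3 by omega]
      generalize (d / 3).toNat = k at hk ⊢
      split_ifs <;> omega
  · exact fun s s' hs hs' => slotDefect_injective (Or.inl rfl) hs.1 hs'.1
  · intro b hb
    have hm := hb.mem
    have ho := hb.outside
    have hsame := hb.same
    have hshift := hb.shift
    have hlink := hb.link
    simp only [evenStrip] at hm ho hsame hshift hlink
    have hrow : ∀ k : ℕ, k < n → (k : ℤ) ≤ b (3 * k) ∧ b (3 * k) ≤ 2 * k ∧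
        (b (3 * k + 1) = b (3 * k) ∨ b (3 * k + 1) = b (3 * k) + 1) ∧
        (k + 1 < n → b (3 * k + 2) = b (3 * k + 1)) ∧
        (k + 1 = n → b (3 * k + 2) = b (3 * k + 1) + 1 ∧ b (3 * k + 1) ≤ 2 * k) ∧
        (k + 1 < n → b (3 * k + 2) < b (3 * (k + 1 : ℕ))) := by
      intro k hk
      have h1 := hm (3 * k) (by omega) (by omega)
      have h1' := hm (3 * k + 1) (by omega) (by omega)
      have h2 := hsame (3 * k + 1) (by omega) (by omega) (by omega)
      have h2' := hshift (3 * k + 1) (by omega) (by omega) (by omega)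
      have h3 := hlink (3 * k) (by omega) (by omega) (by omega)
      have h4 := hlink (3 * k + 1) (by omega) (by omega) (by omega)
      have h5 := hshift (3 * k + 2) (by omega) (by omega) (by omega)
      rw [show (3 * k + 1 + 1 : ℤ) = 3 * k + 2 by ring] at h2 h2' h4
      rw [show (3 * k + 2 + 1 : ℤ) = 3 * (k + 1 : ℕ) by push_cast; ring] at h5
      by_cases hkn : k + 1 < n
      · rw [if_neg (by omega), if_pos (by omega)] at h1 h1'
        rw [if_neg (by omega), if_neg (by omega)] at h2 h5
        omega
      · rw [if_neg (by omega), if_pos (by omega)] at h1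
        rw [if_neg (by omega), if_neg (by omega), if_pos (by omega)] at h1'
        rw [if_pos (by omega), if_neg (by omega)] at h2'
        omega
    refine ⟨fun k => if k < n then (b (3 * k) - k + (b (3 * k + 1) - k)).toNat else 0,
      ⟨⟨?_, ?_, ?_⟩, ?_⟩, ?_⟩
    · intro k hk
      have := hrow k hk
      rw [if_pos hk]
      omega
    · intro k hk
      have h1 := hrow k (by omega)
      have h2 := hrow (k + 1) hk
      rw [if_pos (by omega), if_pos hk]
      omega
    · intro k hk
      rw [if_neg (by omega)]
    · have := hrow (n - 1) (by omega)
      simp only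
      rw [if_pos (by omega)]
      omega
    · funext d
      by_cases hd : 0 ≤ d ∧ d < 3 * n
      · obtain ⟨k, hk⟩ : ∃ k : ℕ, (k : ℤ) = d / 3 := ⟨(d / 3).toNat, by omega⟩
        have hkn : k < n := by omega
        have := hrow k hkn
        rw [slotDefect_of_lt hkn (i := d % 3) (by omega) (by omega) (by omega), if_pos hkn]
        have : d = 3 * k ∨ d = 3 * k + 1 ∨ d = 3 * k + 2 := by omega
        rcases this with rfl | rfl | rfl <;> split_ifs <;> omega
      · rw [slotDefect, if_neg hd, ho d (by omega)]
        rfl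

/-! ### Counting slot sequences -/

/-- The slot sequences whose Schröder path reaches height at most `p` by its last horizontal or
diagonal step. -/
def slotSeqsBelow (n p : ℕ) : Set (ℕ → ℕ) :=
  {s | IsSlotSeq n s ∧ (n ≠ 0 → s (n - 1) ≤ 2 * p)}

theorem slotSeqsBelow_self (n : ℕ) : slotSeqsBelow n n = {s | IsSlotSeq n s} := by
  ext s
  refine ⟨fun h => h.1, fun h => ⟨h, fun hn => ?_⟩⟩
  have := h.le (n - 1) (by omega)
  omega

/-- A slot sequence with prescribed last term is an extension of a shorter one. -/
theorem encard_isSlotSeq_last (n σ : ℕ) (hσ : σ ≤ 2 * n + 1) :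
    Set.encard {s | IsSlotSeq (n + 1) s ∧ s n = σ} = Set.encard (slotSeqsBelow n (σ / 2)) := by
  have himage : {s | IsSlotSeq (n + 1) s ∧ s n = σ} =
      (fun s => Function.update s n σ) '' slotSeqsBelow n (σ / 2) := by
    ext s
    constructor
    · rintro ⟨h, hs⟩
      refine ⟨Function.update s n 0, ⟨⟨?_, ?_, ?_⟩, ?_⟩, ?_⟩
      · intro k hk
        rw [Function.update_of_ne (by omega)]
        exact h.le k (by omega)
      · intro k hk
        rw [Function.update_of_ne (by omega), Function.update_of_ne (by omega)]
        exact h.mono k (by omega)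
      · intro k hk
        rcases eq_or_ne k n with rfl | hne
        · simp
        · rw [Function.update_of_ne hne]
          exact h.zero k (by omega)
      · intro hn
        rw [Function.update_of_ne (by omega)]
        have := h.mono (n - 1) (by omega)
        rw [show n - 1 + 1 = n by omega, hs] at this
        omega
      · simp [← hs]
    · rintro ⟨s, ⟨h, hs⟩, rfl⟩
      refine ⟨⟨?_, ?_, ?_⟩, by simp⟩
      · intro k hk
        rcases eq_or_ne k n with rfl | hne
        · simpa using hσ
        · simp only [Function.update_of_ne hne]
          exact h.le k (by omega)
      · intro k hk
        simp only
        rw [Function.update_of_ne (by omega)]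
        rcases eq_or_ne (k + 1) n with rfl | hne
        · have := hs (by omega)
          rw [show k + 1 - 1 = k by omega] at this
          rw [Function.update_self]
          omega
        · rw [Function.update_of_ne hne]
          exact h.mono k (by omega)
      · intro k hk
        simp only
        rw [Function.update_of_ne (by omega)]
        exact h.zero k (by omega)
  rw [himage, Set.InjOn.encard_image]
  intro s hs s' hs' e
  funext k
  rcases eq_or_ne k n with rfl | hne
  · rw [hs.1.zero k le_rfl, hs'.1.zero k le_rfl]
  · have := congrFun e k
    simpa [Function.update_of_ne hne] using this

open PowerSeries in
/-- The powers of the Schröder series satisfy the recurrence of the numbers of Schröder paths with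
a given endpoint, the exponent being one more than the distance to the diagonal. -/
theorem coeff_succ_largeSchroderSeries_pow (m p : ℕ) :
    coeff (p + 1) (largeSchroderSeries ^ (m + 1)) = coeff p (largeSchroderSeries ^ (m + 2)) +
      coeff p (largeSchroderSeries ^ (m + 1)) + coeff (p + 1) (largeSchroderSeries ^ m) := by
  have h : largeSchroderSeries ^ (m + 1) = largeSchroderSeries ^ m +
      X * largeSchroderSeries ^ (m + 1) + X * largeSchroderSeries ^ (m + 2) := by
    calc largeSchroderSeries ^ (m + 1)
        = largeSchroderSeries ^ m * largeSchroderSeries := pow_succ _ _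
      _ = largeSchroderSeries ^ m *
          (1 + X * largeSchroderSeries + X * largeSchroderSeries ^ 2) := by
        congr 1
        exact largeSchroderSeries_eq_one_add_X_mul_largeSchroderSeries_add_X_mul_largeSchroderSeries_sq
      _ = _ := by ring
  conv_lhs => rw [h]
  rw [map_add, map_add, coeff_succ_X_mul, coeff_succ_X_mul]
  ring

open PowerSeries in
theorem encard_slotSeqsBelow (n : ℕ) : ∀ p ≤ n, Set.encard (slotSeqsBelow n p) =
    ((coeff p (largeSchroderSeries ^ (n - p + 1)) : ℕ) : ℕ∞) := by
  induction n with
  | zero =>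
    intro p hp
    obtain rfl : p = 0 := by omega
    have : slotSeqsBelow 0 0 = {fun _ => 0} := by
      ext s
      constructor
      · rintro ⟨h, -⟩
        exact funext fun k => h.zero k (by omega)
      · rintro rfl
        exact ⟨⟨fun k hk => by omega, fun k hk => by omega, fun k hk => rfl⟩, fun h => absurd rfl h⟩
    rw [this, Set.encard_singleton]
    simp
  | succ n ih =>
    intro p
    induction p with
    | zero =>
      intro _
      have : slotSeqsBelow (n + 1) 0 = {s | IsSlotSeq (n + 1) s ∧ s n = 0} := by
        ext s
        simp [slotSeqsBelow]
      rw [this, encard_isSlotSeq_last n 0 (by omega), ih 0 (by omega)]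
      simp
    | succ p ihp =>
      intro hp
      have hdecomp : slotSeqsBelow (n + 1) (p + 1) = (slotSeqsBelow (n + 1) p ∪
          {s | IsSlotSeq (n + 1) s ∧ s n = 2 * p + 1}) ∪
          {s | IsSlotSeq (n + 1) s ∧ s n = 2 * p + 2} := by
        ext s
        simp only [slotSeqsBelow, Set.mem_ofPred_eq, Set.mem_union, Nat.add_sub_cancel, ne_eq,
          Nat.succ_ne_zero, not_false_eq_true, true_implies]
        constructor
        · rintro ⟨h, hs⟩
          have : s n ≤ 2 * p ∨ s n = 2 * p + 1 ∨ s n = 2 * p + 2 := by omega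
          tauto
        · rintro ((⟨h, hs⟩ | ⟨h, hs⟩) | ⟨h, hs⟩) <;> exact ⟨h, by omega⟩
      have hlast : Set.encard {s | IsSlotSeq (n + 1) s ∧ s n = 2 * p + 2} =
          ((coeff (p + 1) (largeSchroderSeries ^ (n - p)) : ℕ) : ℕ∞) := by
        by_cases hpn : p + 1 ≤ n
        · rw [encard_isSlotSeq_last n _ (by omega), show (2 * p + 2) / 2 = p + 1 by omega,
            ih _ hpn, show n - (p + 1) + 1 = n - p by omega]
        · have : {s | IsSlotSeq (n + 1) s ∧ s n = 2 * p + 2} = ∅ := by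
            ext s
            simp only [Set.mem_ofPred_eq, Set.mem_empty_iff_false, iff_false]
            rintro ⟨h, hs⟩
            have := h.le n (by omega)
            omega
          rw [this, Set.encard_empty, show n - p = 0 by omega, pow_zero, coeff_one,
            if_neg (by omega), Nat.cast_zero]
      rw [hdecomp, Set.encard_union_eq, Set.encard_union_eq, ihp (by omega), hlast,
        encard_isSlotSeq_last n _ (by omega), show (2 * p + 1) / 2 = p by omega, ih p (by omega),
        show n + 1 - (p + 1) + 1 = n - p + 1 by omega, show n + 1 - p + 1 = n - p + 2 by omega,
        coeff_succ_largeSchroderSeries_pow]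
      · push_cast; rfl
      · rw [Set.disjoint_left]
        rintro s ⟨h, h1⟩ ⟨-, h2⟩
        have := h1 (by omega)
        simp only [Nat.add_sub_cancel] at this
        omega
      · rw [Set.disjoint_left]
        rintro s (⟨h, h1⟩ | ⟨h, h1⟩) ⟨-, h2⟩
        · have := h1 (by omega)
          simp only [Nat.add_sub_cancel] at this
          omega
        · omega

theorem encard_isSlotSeq (n : ℕ) :
    Set.encard {s | IsSlotSeq n s} = (Nat.largeSchroder n : ℕ∞) := by
  rw [← slotSeqsBelow_self, encard_slotSeqsBelow n n le_rfl]
  simp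

theorem ncard_isSlotSeq (n : ℕ) : Set.ncard {s | IsSlotSeq n s} = Nat.largeSchroder n := by
  rw [Set.ncard_def, encard_isSlotSeq]
  rfl

theorem ncard_isSlotSeq_last_ne (n : ℕ) :
    Set.ncard {s | IsSlotSeq (n + 1) s ∧ s n ≠ 2 * n + 1} + Nat.largeSchroder n =
      Nat.largeSchroder (n + 1) := by
  have hlast : Set.encard {s | IsSlotSeq (n + 1) s ∧ s n = 2 * n + 1} =
      (Nat.largeSchroder n : ℕ∞) := by
    rw [encard_isSlotSeq_last n _ le_rfl, show (2 * n + 1) / 2 = n by omega, slotSeqsBelow_self,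
      encard_isSlotSeq]
  have hfin : Set.Finite {s | IsSlotSeq (n + 1) s} :=
    Set.finite_of_encard_eq_coe (encard_isSlotSeq (n + 1))
  have hunion : {s | IsSlotSeq (n + 1) s} = {s | IsSlotSeq (n + 1) s ∧ s n ≠ 2 * n + 1} ∪
      {s | IsSlotSeq (n + 1) s ∧ s n = 2 * n + 1} := by
    ext s
    simp only [Set.mem_ofPred_eq, Set.mem_union]
    tauto
  have h := ncard_isSlotSeq (n + 1)
  rw [hunion, Set.ncard_union_eq ?_ (hfin.subset fun s hs => hs.1)
    (hfin.subset fun s hs => hs.1)] at h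
  · rw [← h, Set.ncard_def {s | IsSlotSeq (n + 1) s ∧ s n = 2 * n + 1}, hlast]
    rfl
  · rw [Set.disjoint_left]
    rintro s ⟨-, h1⟩ ⟨-, h2⟩
    exact h1 h2

/-! ### The cells of a benzel -/

theorem omega_sq : omega ^ 2 = -1 - omega := by
  have h : IsPrimitiveRoot omega 3 := Complex.isPrimitiveRoot_exp 3 (by norm_num)
  have := h.geom_sum_eq_zero (by norm_num)
  simp only [Finset.sum_range_succ, Finset.sum_range_zero, pow_zero, pow_one, zero_add] at this
  linear_combination this

theorem omega_pow_three : omega ^ 3 = 1 :=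
  (Complex.isPrimitiveRoot_exp 3 (by norm_num) : IsPrimitiveRoot omega 3).pow_eq_one

/-- The complex number with coordinates `x` and `y` in the basis `1, ω`. -/
noncomputable def point (x y : ℝ) : ℂ := x + y * omega

theorem omega_im_pos : 0 < omega.im := by
  rw [omega, show (2 * Real.pi * Complex.I / 3 : ℂ) = ((2 * Real.pi / 3 : ℝ) : ℂ) * Complex.I by
    push_cast; ring, Complex.exp_ofReal_mul_I_im]
  exact Real.sin_pos_of_pos_of_lt_pi (by positivity) (by linarith [Real.pi_pos])

/-- The coordinate along `ω` in the basis `1, ω`. -/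
noncomputable def coordY : ℂ →ₗ[ℝ] ℝ := (omega.im)⁻¹ • Complex.imLm

/-- The coordinate along `1` in the basis `1, ω`. -/
noncomputable def coordX : ℂ →ₗ[ℝ] ℝ := Complex.reLm - omega.re • coordY

@[simp] theorem coordY_point (x y : ℝ) : coordY (point x y) = y := by
  have := omega_im_pos.ne'
  simp [coordY, point]
  field_simp

@[simp] theorem coordX_point (x y : ℝ) : coordX (point x y) = x := by
  simp only [coordX, LinearMap.sub_apply, LinearMap.smul_apply, coordY_point]
  simp [point]
  ring

theorem boundingHexagon_eq (a b : ℕ) : boundingHexagon a b = convexHull ℝ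
    {point b a, point (-a) (b - a), point (a - b) (-b), point (-a) (-b), point b (b - a),
      point (a - b) a} := by
  have h2 := omega_sq
  have h3 := omega_pow_three
  have key : ∀ z : ℂ, (∃ j : Fin 3, z = omega ^ (j : ℕ) * ((a : ℂ) * omega + (b : ℂ)) ∨
      z = -(omega ^ (j : ℕ) * ((a : ℂ) + (b : ℂ) * omega))) ↔
      z = point b a ∨ z = point (-a) (b - a) ∨ z = point (a - b) (-b) ∨
      z = point (-a) (-b) ∨ z = point b (b - a) ∨ z = point (a - b) a := by
    intro z
    have e0 : omega ^ 0 * ((a : ℂ) * omega + (b : ℂ)) = point b a := by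
      simp only [point]; push_cast; ring
    have e1 : omega ^ 1 * ((a : ℂ) * omega + (b : ℂ)) = point (-a) (b - a) := by
      simp only [point]; push_cast; linear_combination a * h2
    have e2 : omega ^ 2 * ((a : ℂ) * omega + (b : ℂ)) = point (a - b) (-b) := by
      simp only [point]; push_cast; linear_combination a * h3 + b * h2
    have f0 : -(omega ^ 0 * ((a : ℂ) + (b : ℂ) * omega)) = point (-a) (-b) := by
      simp only [point]; push_cast; ring
    have f1 : -(omega ^ 1 * ((a : ℂ) + (b : ℂ) * omega)) = point b (b - a) := by
      simp only [point]; push_cast; linear_combination -b * h2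
    have f2 : -(omega ^ 2 * ((a : ℂ) + (b : ℂ) * omega)) = point (a - b) a := by
      simp only [point]; push_cast; linear_combination -b * h3 - a * h2
    rw [← e0, ← e1, ← e2, ← f0, ← f1, ← f2]
    simp only [Fin.exists_fin_succ, Fin.val_zero, Fin.val_succ, IsEmpty.exists_iff, or_false]
    norm_num
    tauto
  rw [boundingHexagon]
  congr 1
  ext z
  simpa only [Set.mem_ofPred_eq, Set.mem_insert_iff, Set.mem_singleton_iff] using key z

theorem hexagon_eq (c : Cell) : Cell.hexagon c = convexHull ℝ
    {point (1 + 2 * c.1 + c.2 + 1) (c.1 - c.2), point (1 + 2 * c.1 + c.2 - 1) (c.1 - c.2),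
      point (1 + 2 * c.1 + c.2) (c.1 - c.2 + 1), point (1 + 2 * c.1 + c.2) (c.1 - c.2 - 1),
      point (1 + 2 * c.1 + c.2 - 1) (c.1 - c.2 - 1),
      point (1 + 2 * c.1 + c.2 + 1) (c.1 - c.2 + 1)} := by
  have h2 := omega_sq
  have key : ∀ z : ℂ, (∃ j : Fin 3, z = Cell.center c + omega ^ (j : ℕ) ∨
      z = Cell.center c - omega ^ (j : ℕ)) ↔
      z = point (1 + 2 * c.1 + c.2 + 1) (c.1 - c.2) ∨
      z = point (1 + 2 * c.1 + c.2 - 1) (c.1 - c.2) ∨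
      z = point (1 + 2 * c.1 + c.2) (c.1 - c.2 + 1) ∨
      z = point (1 + 2 * c.1 + c.2) (c.1 - c.2 - 1) ∨
      z = point (1 + 2 * c.1 + c.2 - 1) (c.1 - c.2 - 1) ∨
      z = point (1 + 2 * c.1 + c.2 + 1) (c.1 - c.2 + 1) := by
    intro z
    have e0 : Cell.center c + omega ^ 0 = point (1 + 2 * c.1 + c.2 + 1) (c.1 - c.2) := by
      simp only [point, Cell.center]; push_cast; linear_combination -c.1 * h2
    have e1 : Cell.center c - omega ^ 0 = point (1 + 2 * c.1 + c.2 - 1) (c.1 - c.2) := by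
      simp only [point, Cell.center]; push_cast; linear_combination -c.1 * h2
    have e2 : Cell.center c + omega ^ 1 = point (1 + 2 * c.1 + c.2) (c.1 - c.2 + 1) := by
      simp only [point, Cell.center]; push_cast; linear_combination -c.1 * h2
    have e3 : Cell.center c - omega ^ 1 = point (1 + 2 * c.1 + c.2) (c.1 - c.2 - 1) := by
      simp only [point, Cell.center]; push_cast; linear_combination -c.1 * h2
    have e4 : Cell.center c + omega ^ 2 =
        point (1 + 2 * c.1 + c.2 - 1) (c.1 - c.2 - 1) := by
      simp only [point, Cell.center]; push_cast; linear_combination (1 - c.1) * h2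
    have e5 : Cell.center c - omega ^ 2 =
        point (1 + 2 * c.1 + c.2 + 1) (c.1 - c.2 + 1) := by
      simp only [point, Cell.center]; push_cast; linear_combination (-1 - c.1) * h2
    rw [← e0, ← e1, ← e2, ← e3, ← e4, ← e5]
    simp only [Fin.exists_fin_succ, Fin.val_zero, Fin.val_succ, IsEmpty.exists_iff, or_false]
    norm_num
    tauto
  rw [Cell.hexagon]
  congr 1
  ext z
  simpa only [Set.mem_ofPred_eq, Set.mem_insert_iff, Set.mem_singleton_iff] using key z

/-- A point that is a combination of two points of a convex set with weights `s, t`, not normalized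
to have sum 1. -/
theorem point_mem_of_convex {C : Set ℂ} (hC : Convex ℝ C) {x₁ y₁ x₂ y₂ x y s t : ℝ}
    (h₁ : point x₁ y₁ ∈ C) (h₂ : point x₂ y₂ ∈ C) (hs : 0 ≤ s) (ht : 0 ≤ t) (hst : 0 < s + t)
    (hx : (s + t) * x = s * x₁ + t * x₂) (hy : (s + t) * y = s * y₁ + t * y₂) :
    point x y ∈ C := by
  have h := hC h₁ h₂ (div_nonneg hs hst.le) (div_nonneg ht hst.le)
    (by rw [← add_div, div_self hst.ne'])
  have ex : x = s / (s + t) * x₁ + t / (s + t) * x₂ := by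
    field_simp; linarith
  have ey : y = s / (s + t) * y₁ + t / (s + t) * y₂ := by
    field_simp; linarith
  convert h using 1
  rw [ex, ey]
  simp only [point, Complex.real_smul]
  push_cast
  ring

/-- The bounding hexagon is cut out by six inequalities. -/
theorem point_mem_boundingHexagon_iff {a b : ℕ} (hab : a < 2 * b) (hba : b < 2 * a) (x y : ℝ) :
    point x y ∈ boundingHexagon a b ↔
      (-a ≤ x ∧ x ≤ b) ∧ (-b ≤ y ∧ y ≤ a) ∧ (-b ≤ x - y ∧ x - y ≤ a) := by
  have hab' : (a : ℝ) < 2 * b := by exact_mod_cast hab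
  have hba' : (b : ℝ) < 2 * a := by exact_mod_cast hba
  have ha : (0 : ℝ) ≤ a := Nat.cast_nonneg a
  have hb : (0 : ℝ) ≤ b := Nat.cast_nonneg b
  rw [boundingHexagon_eq]
  constructor
  · intro h
    have hconv : Convex ℝ {z : ℂ | ((-a ≤ coordX z ∧ coordX z ≤ b) ∧
        (-b ≤ coordY z ∧ coordY z ≤ a)) ∧
        (-b ≤ (coordX - coordY) z ∧ (coordX - coordY) z ≤ a)} :=
      (((convex_halfSpace_ge coordX.isLinear _).inter (convex_halfSpace_le coordX.isLinear _)).inter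
        ((convex_halfSpace_ge coordY.isLinear _).inter
          (convex_halfSpace_le coordY.isLinear _))).inter
        ((convex_halfSpace_ge (coordX - coordY).isLinear _).inter
          (convex_halfSpace_le (coordX - coordY).isLinear _))
    have hsub := convexHull_min (t := {z : ℂ | ((-a ≤ coordX z ∧ coordX z ≤ b) ∧
        (-b ≤ coordY z ∧ coordY z ≤ a)) ∧
        (-b ≤ (coordX - coordY) z ∧ (coordX - coordY) z ≤ a)}) ?_ hconv h
    · simp only [Set.mem_ofPred_eq, LinearMap.sub_apply, coordX_point, coordY_point] at hsub
      tauto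
    · intro z hz
      simp only [Set.mem_insert_iff, Set.mem_singleton_iff] at hz
      rcases hz with rfl | rfl | rfl | rfl | rfl | rfl <;>
        simp only [Set.mem_ofPred_eq, LinearMap.sub_apply, coordX_point, coordY_point] <;>
        refine ⟨⟨⟨?_, ?_⟩, ?_, ?_⟩, ?_, ?_⟩ <;> linarith
  · rintro ⟨⟨h1, h2⟩, ⟨h3, h4⟩, h5, h6⟩
    set V : Set ℂ := {point b a, point (-a) (b - a), point (a - b) (-b), point (-a) (-b),
      point b (b - a), point (a - b) a} with hV
    have hC : Convex ℝ (convexHull ℝ V) := convex_convexHull ℝ V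
    have m1 : point b a ∈ convexHull ℝ V := subset_convexHull ℝ V (by simp [hV])
    have m2 : point (-a) (b - a) ∈ convexHull ℝ V := subset_convexHull ℝ V (by simp [hV])
    have m3 : point (a - b) (-b) ∈ convexHull ℝ V := subset_convexHull ℝ V (by simp [hV])
    have m4 : point (-a) (-b) ∈ convexHull ℝ V := subset_convexHull ℝ V (by simp [hV])
    have m5 : point b (b - a) ∈ convexHull ℝ V := subset_convexHull ℝ V (by simp [hV])
    have m6 : point (a - b) a ∈ convexHull ℝ V := subset_convexHull ℝ V (by simp [hV])
    -- the two ends `l ≤ x ≤ r` of the section of the hexagon at height `y`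
    rcases le_total y (b - a) with hy | hy
    · have hl : point (-a) y ∈ convexHull ℝ V :=
        point_mem_of_convex hC m4 m2 (s := b - a - y) (t := y + b) (by linarith) (by linarith)
          (by linarith) (by ring) (by ring)
      have hr : point (y + a) y ∈ convexHull ℝ V :=
        point_mem_of_convex hC m3 m5 (s := b - a - y) (t := y + b) (by linarith) (by linarith)
          (by linarith) (by ring) (by ring)
      exact point_mem_of_convex hC hl hr (s := y + a - x) (t := x + a) (by linarith) (by linarith)
        (by linarith) (by ring) (by ring)
    · have hl : point (y - b) y ∈ convexHull ℝ V :=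
        point_mem_of_convex hC m2 m6 (s := a - y) (t := y - (b - a)) (by linarith) (by linarith)
          (by linarith) (by ring) (by ring)
      have hr : point b y ∈ convexHull ℝ V :=
        point_mem_of_convex hC m5 m1 (s := a - y) (t := y - (b - a)) (by linarith) (by linarith)
          (by linarith) (by ring) (by ring)
      exact point_mem_of_convex hC hl hr (s := b - x) (t := x - (y - b)) (by linarith)
        (by linarith) (by linarith) (by ring) (by ring)

theorem mem_benzel_iff {a b : ℕ} (hab : a < 2 * b) (hba : b < 2 * a) (c : Cell) :
    c ∈ benzel a b ↔ (-a ≤ 2 * c.1 + c.2 ∧ 2 * c.1 + c.2 + 2 ≤ b) ∧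
      (1 - b ≤ c.1 - c.2 ∧ c.1 - c.2 + 1 ≤ a) ∧
      (-b ≤ c.1 + 2 * c.2 ∧ c.1 + 2 * c.2 + 2 ≤ a) := by
  have hhull : c ∈ benzel a b ↔ ∀ z ∈ ({point (1 + 2 * c.1 + c.2 + 1) (c.1 - c.2),
      point (1 + 2 * c.1 + c.2 - 1) (c.1 - c.2), point (1 + 2 * c.1 + c.2) (c.1 - c.2 + 1),
      point (1 + 2 * c.1 + c.2) (c.1 - c.2 - 1), point (1 + 2 * c.1 + c.2 - 1) (c.1 - c.2 - 1),
      point (1 + 2 * c.1 + c.2 + 1) (c.1 - c.2 + 1)} : Set ℂ), z ∈ boundingHexagon a b := by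
    have hconv : Convex ℝ (boundingHexagon a b) := convex_convexHull ℝ _
    change Cell.hexagon c ⊆ boundingHexagon a b ↔ _
    rw [hexagon_eq, hconv.convexHull_subset_iff]
    rfl
  rw [hhull]
  simp only [Set.mem_insert_iff, Set.mem_singleton_iff, forall_eq_or_imp, forall_eq,
    point_mem_boundingHexagon_iff hab hba]
  have hcast : ((-a ≤ 2 * c.1 + c.2 ∧ 2 * c.1 + c.2 + 2 ≤ b) ∧
      (1 - b ≤ c.1 - c.2 ∧ c.1 - c.2 + 1 ≤ a) ∧
      (-b ≤ c.1 + 2 * c.2 ∧ c.1 + 2 * c.2 + 2 ≤ a)) ↔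
      ((-a ≤ 2 * (c.1 : ℝ) + c.2 ∧ 2 * (c.1 : ℝ) + c.2 + 2 ≤ b) ∧
      (1 - b ≤ (c.1 : ℝ) - c.2 ∧ (c.1 : ℝ) - c.2 + 1 ≤ a) ∧
      (-b ≤ (c.1 : ℝ) + 2 * c.2 ∧ (c.1 : ℝ) + 2 * c.2 + 2 ≤ a)) := by
    norm_cast
  rw [hcast]
  constructor
  · intro h
    refine ⟨⟨?_, ?_⟩, ⟨?_, ?_⟩, ?_, ?_⟩ <;> linarith [h.1.1.2, h.2.1.1.1, h.2.2.1.2.1.2,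
      h.2.2.2.1.2.1.1, h.1.2.2.2, h.2.1.2.2.1]
  · rintro ⟨⟨h1, h2⟩, ⟨h3, h4⟩, h5, h6⟩
    refine ⟨?_, ?_, ?_, ?_, ?_, ?_⟩ <;> refine ⟨⟨?_, ?_⟩, ⟨?_, ?_⟩, ?_, ?_⟩ <;> linarith

/-! ### From benzels to strips -/

/-- The tiles other than vertical bones are the paths of three cells whose steps are rightward, up
or down, to an adjacent cell. -/
theorem exists_place_iff (t : Finset Cell) :
    (∃ p ∈ allButVertical, ∃ c : Cell, t = Prototile.place p c) ↔
      ∃ c δ ε : Cell, (δ = (1, 0) ∨ δ = (0, -1)) ∧ (ε = (1, 0) ∨ ε = (0, -1)) ∧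
        t = {c, c + δ, c + δ + ε} := by
  have hleft : ∀ c : Cell, Prototile.place .leftStone c =
      {c + (0, 1), c + (0, 1) + (0, -1), c + (0, 1) + (0, -1) + (1, 0)} := by
    rintro ⟨u, v⟩
    ext ⟨u', v'⟩
    simp only [Prototile.place, Finset.mem_insert, Finset.mem_singleton, Prod.mk_add_mk,
      Prod.mk.injEq]
    omega
  have hright : ∀ c : Cell, Prototile.place .rightStone c =
      {c, c + (1, 0), c + (1, 0) + (0, -1)} := by
    rintro ⟨u, v⟩
    ext ⟨u', v'⟩
    simp only [Prototile.place, Finset.mem_insert, Finset.mem_singleton, Prod.mk_add_mk,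
      Prod.mk.injEq]
    omega
  have hrising : ∀ c : Cell, Prototile.place .risingBone c =
      {c, c + (1, 0), c + (1, 0) + (1, 0)} := by
    rintro ⟨u, v⟩
    ext ⟨u', v'⟩
    simp only [Prototile.place, Finset.mem_insert, Finset.mem_singleton, Prod.mk_add_mk,
      Prod.mk.injEq]
    omega
  have hfalling : ∀ c : Cell, Prototile.place .fallingBone c =
      {c + (0, 2), c + (0, 2) + (0, -1), c + (0, 2) + (0, -1) + (0, -1)} := by
    rintro ⟨u, v⟩
    ext ⟨u', v'⟩
    simp only [Prototile.place, Finset.mem_insert, Finset.mem_singleton, Prod.mk_add_mk,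
      Prod.mk.injEq]
    omega
  constructor
  · rintro ⟨p, hp, c, rfl⟩
    simp only [allButVertical, Set.mem_insert_iff, Set.mem_singleton_iff] at hp
    rcases hp with rfl | rfl | rfl | rfl
    · exact ⟨_, _, _, Or.inr rfl, Or.inl rfl, hleft c⟩
    · exact ⟨_, _, _, Or.inl rfl, Or.inr rfl, hright c⟩
    · exact ⟨_, _, _, Or.inl rfl, Or.inl rfl, hrising c⟩
    · exact ⟨_, _, _, Or.inr rfl, Or.inr rfl, hfalling c⟩
  · rintro ⟨c, δ, ε, rfl | rfl, rfl | rfl, rfl⟩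
    · exact ⟨_, by simp [allButVertical], c, (hrising c).symm⟩
    · exact ⟨_, by simp [allButVertical], c, (hright c).symm⟩
    · refine ⟨.leftStone, by simp [allButVertical], c - (0, 1), ?_⟩
      rw [hleft, sub_add_cancel]
    · refine ⟨.fallingBone, by simp [allButVertical], c - (0, 2), ?_⟩
      rw [hfalling, sub_add_cancel]

/-- Tilings without vertical bones are path tilings, in coordinates whose two steps from a column to
the next are the steps `(1, 0)` and `(0, -1)` of cells. -/
theorem numTilings_allButVertical (e : ℤ × ℤ ≃ Cell) (δ : ℤ → Cell)
    (he : ∀ d w i, i = 0 ∨ i = 1 → e (d + 1, w + i) = e (d, w) + δ i)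
    (hδ : (δ 0 = (1, 0) ∧ δ 1 = (0, -1)) ∨ (δ 0 = (0, -1) ∧ δ 1 = (1, 0))) (R : Set Cell) :
    numTilings allButVertical R = Set.ncard {𝒯 | IsPathTiling (e ⁻¹' R) 𝒯} := by
  have htile : ∀ s : Finset (ℤ × ℤ), IsPathTile s ↔
      ∃ p ∈ allButVertical, ∃ c : Cell, e.finsetCongr s = Prototile.place p c := by
    intro s
    rw [exists_place_iff]
    have hmap : ∀ d w i j : ℤ, (i = 0 ∨ i = 1) → (j = 0 ∨ j = 1) →
        e.finsetCongr {(d, w), (d + 1, w + i), (d + 2, w + i + j)} =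
          {e (d, w), e (d, w) + δ i, e (d, w) + δ i + δ j} := by
      intro d w i j hi hj
      rw [← he d w i hi, ← he _ _ j hj, show d + 1 + 1 = d + 2 by ring]
      simp [Equiv.finsetCongr_apply]
    constructor
    · rintro ⟨d, w, i, j, hi, hj, rfl⟩
      refine ⟨e (d, w), δ i, δ j, ?_, ?_, hmap d w i j hi hj⟩
      · rcases hi with rfl | rfl <;> rcases hδ with ⟨h0, h1⟩ | ⟨h0, h1⟩ <;> simp [h0, h1]
      · rcases hj with rfl | rfl <;> rcases hδ with ⟨h0, h1⟩ | ⟨h0, h1⟩ <;> simp [h0, h1]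
    · rintro ⟨c, α, β, hα, hβ, h⟩
      have hindex : ∀ γ : Cell, γ = (1, 0) ∨ γ = (0, -1) →
          ∃ i : ℤ, (i = 0 ∨ i = 1) ∧ γ = δ i := by
        rintro γ (rfl | rfl) <;> rcases hδ with ⟨h0, h1⟩ | ⟨h0, h1⟩
        · exact ⟨0, Or.inl rfl, h0.symm⟩
        · exact ⟨1, Or.inr rfl, h1.symm⟩
        · exact ⟨1, Or.inr rfl, h1.symm⟩
        · exact ⟨0, Or.inl rfl, h0.symm⟩
      obtain ⟨i, hi, rfl⟩ := hindex α hα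
      obtain ⟨j, hj, rfl⟩ := hindex β hβ
      obtain ⟨⟨d, w⟩, rfl⟩ := e.surjective c
      exact ⟨d, w, i, j, hi, hj, e.finsetCongr.injective (by rw [h, hmap d w i j hi hj])⟩
  have htiling : ∀ 𝒯 : Set (Finset (ℤ × ℤ)),
      IsPathTiling (e ⁻¹' R) 𝒯 ↔ IsTiling allButVertical R (e.finsetCongr '' 𝒯) := by
    intro 𝒯
    refine and_congr ?_ (and_congr ?_ ?_)
    · rw [Set.forall_mem_image]
      exact forall₂_congr fun s _ => htile s
    · rw [Set.forall_mem_image]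
      refine forall₂_congr fun s _ => ?_
      rw [Set.forall_mem_image]
      refine forall₂_congr fun s' _ => ?_
      simp [Equiv.finsetCongr_apply]
    · rw [← e.forall_congr_right (q := fun c => c ∈ R ↔ ∃ t ∈ e.finsetCongr '' 𝒯, c ∈ t)]
      refine forall_congr' fun c => iff_congr Iff.rfl ?_
      rw [Set.exists_mem_image]
      simp [Equiv.finsetCongr_apply]
  rw [numTilings]
  symm
  refine Set.ncard_congr (fun 𝒯 _ => e.finsetCongr '' 𝒯) (fun 𝒯 h => (htiling 𝒯).1 h)
    (fun 𝒯 𝒯' _ _ h => e.finsetCongr.injective.image_injective h) ?_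
  intro 𝒯 h
  have himage : e.finsetCongr '' (e.finsetCongr ⁻¹' 𝒯) = 𝒯 :=
    Set.image_preimage_eq 𝒯 e.finsetCongr.surjective
  refine ⟨e.finsetCongr ⁻¹' 𝒯, (htiling _).2 ?_, himage⟩
  rw [himage]
  exact h

/-- The cell at position `w` in column `d` of the strip of the `(n + 2, 2n + 1)`-benzel. -/
def oddEquiv (n : ℕ) : ℤ × ℤ ≃ Cell where
  toFun c := (c.2 - n, c.2 - c.1 + n)
  invFun c := (c.1 - c.2 + 2 * n, c.1 + n)
  left_inv c := by ext <;> simp only <;> ring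
  right_inv c := by ext <;> simp only <;> ring

/-- The cell at position `w` in column `d` of the strip of the `(n + 2, 2n)`-benzel. -/
def evenEquiv (n : ℕ) : ℤ × ℤ ≃ Cell where
  toFun c := (c.1 - n - c.2, n - 1 - c.2)
  invFun c := (c.1 - c.2 + 2 * n - 1, n - 1 - c.2)
  left_inv c := by ext <;> simp only <;> ring
  right_inv c := by ext <;> simp only <;> ring

theorem oddEquiv_preimage_benzel (n : ℕ) (hn : 1 ≤ n) :
    oddEquiv n ⁻¹' benzel (n + 2) (2 * n + 1) = (oddStrip n hn).region := by
  ext ⟨d, w⟩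
  rw [Set.mem_preimage, mem_benzel_iff (by omega) (by omega), Strip.mem_region]
  simp only [oddEquiv, oddStrip, Equiv.coe_fn_mk]
  push_cast
  constructor
  · intro h
    split_ifs <;> omega
  · intro h
    split_ifs at h <;> omega

theorem evenEquiv_preimage_benzel (n : ℕ) (hn : 1 ≤ n) :
    evenEquiv n ⁻¹' benzel (n + 2) (2 * n) = (evenStrip n hn).region := by
  ext ⟨d, w⟩
  rw [Set.mem_preimage, mem_benzel_iff (by omega) (by omega), Strip.mem_region]
  simp only [evenEquiv, evenStrip, Equiv.coe_fn_mk]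
  push_cast
  constructor
  · intro h
    split_ifs <;> omega
  · intro h
    split_ifs at h <;> omega

theorem countT_eq (n : ℕ) : countT n = Nat.largeSchroder n := by
  rw [countT]
  split_ifs with h
  · simp [h]
  · rw [numTilings_allButVertical (oddEquiv n) (fun i => if i = 0 then (0, -1) else (1, 0)) ?_
      (Or.inr ⟨rfl, rfl⟩), oddEquiv_preimage_benzel n (by omega), Strip.ncard_isPathTiling,
      ncard_oddStrip, ncard_isSlotSeq]
    rintro d w i (rfl | rfl) <;> simp only [oddEquiv, Equiv.coe_fn_mk] <;> ext <;> simp <;> ring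

theorem countT'_add (n : ℕ) :
    countT' (n + 1) + Nat.largeSchroder n = Nat.largeSchroder (n + 1) := by
  rw [countT', if_neg (by omega),
    numTilings_allButVertical (evenEquiv (n + 1)) (fun i => if i = 0 then (1, 0) else (0, -1)) ?_
      (Or.inl ⟨rfl, rfl⟩), evenEquiv_preimage_benzel (n + 1) (by omega),
    Strip.ncard_isPathTiling, ncard_evenStrip, ← ncard_isSlotSeq_last_ne]
  · rfl
  · rintro d w i (rfl | rfl) <;> simp only [evenEquiv, Equiv.coe_fn_mk] <;> ext <;> simp <;> ring

theorem countT'_succ (n : ℕ) : countT' (n + 1) =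
    ∑ k ∈ Finset.range (n + 1), Nat.largeSchroder k * Nat.largeSchroder (n - k) := by
  have h1 := countT'_add n
  have h2 := Nat.largeSchroder_succ n
  have h3 : Finset.Iic n = Finset.range (n + 1) := by ext; simp
  rw [h3] at h2
  omega

open PowerSeries in
/-- The generating function: `1 - x - 2 x R` is the square root of `1 - 6 x + x²`, for `R` the
Schröder series. -/
theorem exists_sqrt_mk_countT' : ∃ S : PowerSeries ℚ,
    S ^ 2 = 1 - 6 * X + X ^ 2 ∧ constantCoeff S = 1 ∧
    2 * X * mk (fun n : ℕ => (countT' n : ℚ)) = (1 - X) * (1 - X - S) := by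
  set R : PowerSeries ℚ := PowerSeries.map (Nat.castRingHom ℚ) largeSchroderSeries with hR
  have hquad : R = 1 + X * R + X * R ^ 2 := by
    have := congrArg (PowerSeries.map (Nat.castRingHom ℚ))
      largeSchroderSeries_eq_one_add_X_mul_largeSchroderSeries_add_X_mul_largeSchroderSeries_sq
    simpa using this
  have hT : mk (fun n : ℕ => (countT' n : ℚ)) = (1 - X) * R := by
    ext n
    rw [sub_mul, one_mul, map_sub, coeff_mk]
    cases n with
    | zero => simp [hR, countT']
    | succ n =>
      have := countT'_add n
      rw [coeff_succ_X_mul, hR, coeff_map, coeff_map, coeff_largeSchroderSeries,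
        coeff_largeSchroderSeries, ← this]
      simp
  refine ⟨1 - X - 2 * X * R, ?_, by simp, ?_⟩
  · linear_combination -4 * X * hquad
  · rw [hT]
    ring

end HexTiling

theorem proposition3p5 :
    (∀ n : ℕ, 1 ≤ n →
      (HexTiling.countT' n : ℤ) = (HexTiling.countT n : ℤ) - (HexTiling.countT (n - 1) : ℤ)) ∧
    (∃ S : PowerSeries ℚ,
      S ^ 2 = 1 - 6 * PowerSeries.X + PowerSeries.X ^ 2 ∧
      PowerSeries.constantCoeff S = 1 ∧
      2 * PowerSeries.X * PowerSeries.mk (fun n : ℕ => (HexTiling.countT' n : ℚ)) =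
        (1 - PowerSeries.X) * (1 - PowerSeries.X - S)) ∧
    (∀ n : ℕ, HexTiling.countT' (n + 1) =
      ∑ k ∈ Finset.range (n + 1), Nat.largeSchroder k * Nat.largeSchroder (n - k)) := by
  refine ⟨?_, HexTiling.exists_sqrt_mk_countT', HexTiling.countT'_succ⟩
  rintro (_ | n) hn
  · omega
  · have := HexTiling.countT'_add n
    rw [HexTiling.countT_eq, Nat.add_sub_cancel, HexTiling.countT_eq]
    omega
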